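/- **Setting.** An étale groupoid is a second countable, locally compact Hausdorff topological groupoid $\mathcal G$ whose range map $r:\mathcal G\to\mathcal G^{(0)}$ onto the unit space is a local homeomorphism; $s$ denotes its source map. Let $\mathcal G^{(n)}$ be the space of composable strings $(g_1,\dots,g_n)$, $s(g_i)=r(g_{i+1})$ (the unit space if $n=0$), with face maps $d_0,\dots,d_n:\mathcal G^{(n)}\to\mathcal G^{(n-1)}$, where $d_0$ drops $g_1$, $d_n$ drops $g_n$, and $d_i$ replaces $g_i,g_{i+1}$ by $g_ig_{i+1}$ for $0<i<n$ (for $n=1$, $d_0=s$ and $d_1=r$). For a discrete abelian group $A$ let $C_c(X,A)$ be the group of compactly supported continuous functions $X\to A$. The groups $C_c(\mathcal G^{(n)},A)$ with $\partial_n=\sum_{i=0}^n(-1)^i d_{i*}$, where $d_{i*}(f)(y)=\sum_{d_i(x)=y}f(x)$, form a chain complex $\mathcal C(\mathcal G,A)$, and $H_n(\mathcal G,A)$ is its $n$-th homology group. Let $\mathcal G,\mathcal G'$ be totally disconnected étale groupoids and let $\pi:\mathcal G\to\mathcal G'$ be a continuous, proper, surjective homomorphism which restricts to a bijection $r^{-1}(x)\to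 r^{-1}(\pi(x))$ for every $x\in\mathcal G^{(0)}$. Composition with the induced maps $\pi^{(n)}:\mathcal G^{(n)}\to\mathcal G'^{(n)}$ gives an injective chain map $\pi^*:\mathcal C(\mathcal G',A)\to\mathcal C(\mathcal G,A)$; let $H_n(\mathcal G/\mathcal G',A)$ be the homology of the quotient complex $\mathcal C(\mathcal G,A)/\mathcal C(\mathcal G',A)$. Let $d$ be a metric on $\mathcal G$ inducing its topology, with Hausdorff distance $d_H$ and diameter $\operatorname{diam}$ for compact subsets. Assume that $\pi$ is regular: for all $x'\in\mathcal G'$ and $\varepsilon>0$ there is an open neighbourhood $U'$ of $x'$ such that for each $y'\in U'$ either $d_H(\pi^{-1}(x'),\pi^{-1}(y'))<\varepsilon$ or $\operatorname{diam}\pi^{-1}(y')<\varepsilon$. Put $$\mathcal G'_\pi=\{x'\in\mathcal G' : \#\pi^{-1}(x')>1\},\qquad \mathcal G_\pi=\pi^{-1}(\mathcal G'_\pi),$$ with the metrics $d'_\pi(x',y')=d_H(\pi^{-1}(x'),\pi^{-1}(y'))$ and $d_\pi(x,y)=d(x,y)+d'_\pi(\pi(x),\pi(y))$. **Theorem.**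 With these metric topologies and the groupoid operations of $\mathcal G$ and $\mathcal G'$, $\mathcal G_\pi$ and $\mathcal G'_\pi$ are étale groupoids, and $\pi$ restricts to a continuous, proper, surjective homomorphism $\mathcal G_\pi\to\mathcal G'_\pi$ that is bijective on range fibres. For every discrete abelian group $A$, the sequences of complexes $$0\to\mathcal C(\mathcal G',A)\xrightarrow{\pi^*}\mathcal C(\mathcal G,A)\to\mathcal C(\mathcal G,A)/\mathcal C(\mathcal G',A)\to0,\qquad 0\to\mathcal C(\mathcal G'_\pi,A)\xrightarrow{\pi^*}\mathcal C(\mathcal G_\pi,A)\to\mathcal C(\mathcal G_\pi,A)/\mathcal C(\mathcal G'_\pi,A)\to0$$ are exact, and the associated long sequences (with the induced maps and the connecting homomorphisms) $$\cdots\to H_n(\mathcal G',A)\to H_n(\mathcal G,A)\to H_n(\mathcal G/\mathcal G',A)\to H_{n-1}(\mathcal G',A)\to\cdots\to H_0(\mathcal G/\mathcal G',A)\to0,$$ $$\cdots\to H_n(\mathcal G'_\pi,A)\to H_n(\mathcal G_\pi,A)\to H_n(\mathcal G_\pi/\mathcal G'_\pi,A)\to H_{n-1}(\mathcal G'_\pi,A)\to\cdots\to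 H_0(\mathcal G_\pi/\mathcal G'_\pi,A)\to0$$ are exact. Moreover there is an isomorphism of chain complexes $$\Pi_*:\mathcal C(\mathcal G,A)/\mathcal C(\mathcal G',A)\to\mathcal C(\mathcal G_\pi,A)/\mathcal C(\mathcal G'_\pi,A)$$ which sends the class of $f\in C_c(\mathcal G^{(n)},A)$ to the class of $f_{K'}\in C_c(\mathcal G_\pi^{(n)},A)$ for every sufficiently large compact open set $K'\subset(\mathcal G'_\pi)^{(n)}$ (that is, for every compact open $K'$ containing some compact open set that depends on $f$), where $f_{K'}$ equals $f$ on $(\pi^{(n)})^{-1}(K')$ and $0$ elsewhere. It induces isomorphisms $H_n(\mathcal G/\mathcal G',A)\cong H_n(\mathcal G_\pi/\mathcal G'_\pi,A)$ for all $n\ge0$. -/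

import Mathlib

open Set Topology CategoryTheory
open scoped CompactlySupported

universe u v

/-- A groupoid, presented by its set `G` of arrows, the units being the identity arrows. The range
and source maps are `r(g) = g g⁻¹` and `s(g) = g⁻¹ g`, and `g h` is defined when `s(g) = r(h)`. -/
class GroupoidStr (G : Type u) where
  rng : G → G
  src : G → G
  inv : G → G
  mul : ∀ g h : G, src g = rng h → G
  rng_rng : ∀ g, rng (rng g) = rng g
  src_rng : ∀ g, src (rng g) = rng g
  rng_src : ∀ g, rng (src g) = src g
  src_src : ∀ g, src (src g) = src g
  rng_inv : ∀ g, rng (inv g) = src g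
  src_inv : ∀ g, src (inv g) = rng g
  rng_mul : ∀ g h e, rng (mul g h e) = rng g
  src_mul : ∀ g h e, src (mul g h e) = src h
  mul_assoc : ∀ g h k (e : src g = rng h) (e' : src h = rng k),
    mul (mul g h e) k ((src_mul g h e).trans e') = mul g (mul h k e') (e.trans (rng_mul h k e').symm)
  rng_mul_self : ∀ g, mul (rng g) g (src_rng g) = g
  mul_src_self : ∀ g, mul g (src g) (rng_src g).symm = g
  mul_inv_self : ∀ g, mul g (inv g) (rng_inv g).symm = rng g
  inv_mul_self : ∀ g, mul (inv g) g (src_inv g) = src g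

namespace GroupoidStr

variable {G : Type u} [GroupoidStr G]

/-- The unit space `G⁽⁰⁾`, with the relative topology when `G` has a topology. -/
def Units (G : Type u) [GroupoidStr G] : Set G := {g | rng g = g}

theorem src_unit {x : G} (hx : rng x = x) : src x = x := by
  have := src_rng x; rwa [hx] at this

theorem mul_congr {g g' h h' : G} (e : src g = rng h) (e' : src g' = rng h') (hg : g = g')
    (hh : h = h') : mul g h e = mul g' h' e' := by
  subst hg; subst hh; rfl

theorem unit_mul {x g : G} (hx : rng x = x) (e : src x = rng g) : mul x g e = g := by
  have h : x = rng g := by rw [← e, src_unit hx]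
  subst h; exact rng_mul_self g

theorem mul_unit {x g : G} (hx : rng x = x) (e : src g = rng x) : mul g x e = g := by
  have h : x = src g := by rw [e, hx]
  subst h; exact mul_src_self g

theorem inv_mul_cancel_left {g h : G} (e : src g = rng h) (e' : src (inv g) = rng (mul g h e)) :
    mul (inv g) (mul g h e) e' = h := by
  rw [← mul_assoc (inv g) g h (src_inv g) e]
  rw [mul_congr _ ((src_src g).trans e) (inv_mul_self g) rfl]
  exact unit_mul (rng_src g) _

theorem mul_inv_cancel_left {g h : G} (e : src (inv g) = rng h)
    (e' : src g = rng (mul (inv g) h e)) :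
    mul g (mul (inv g) h e) e' = h := by
  rw [← mul_assoc g (inv g) h (rng_inv g).symm e]
  rw [mul_congr _ ((src_rng g).trans ((src_inv g).symm.trans e)) (mul_inv_self g) rfl]
  exact unit_mul (rng_rng g) _

theorem mul_left_cancel {g h k : G} (e : src g = rng h) (e' : src g = rng k)
    (hm : mul g h e = mul g k e') : h = k := by
  have h1 := inv_mul_cancel_left e ((src_inv g).trans (rng_mul g h e).symm)
  have h2 := inv_mul_cancel_left e' ((src_inv g).trans (rng_mul g k e').symm)
  rw [← h1, ← h2]
  exact mul_congr _ _ rfl hm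

theorem inv_inv (g : G) : inv (inv g) = g := by
  refine mul_left_cancel (g := inv g) (rng_inv _).symm (src_inv g) ?_
  rw [mul_inv_self, inv_mul_self, rng_inv]

theorem eq_src_of_mul_eq_self {g h : G} (e : src g = rng h) (hm : mul g h e = g) :
    h = src g :=
  mul_left_cancel e (rng_src g).symm (hm.trans (mul_src_self g).symm)

end GroupoidStr

open GroupoidStr

/-- An étale groupoid: a second countable locally compact Hausdorff topological groupoid whose
range map onto the unit space is a local homeomorphism. -/
class IsEtale (G : Type u) [TopologicalSpace G] [GroupoidStr G] : Prop
    extends T2Space G, LocallyCompactSpace G, SecondCountableTopology G where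
  continuous_inv : Continuous (inv : G → G)
  continuous_mul : Continuous fun p : {p : G × G // src p.1 = rng p.2} => mul p.1.1 p.1.2 p.2
  isLocalHomeomorph_rng : IsLocalHomeomorph fun g : G => (⟨rng g, rng_rng g⟩ : Units G)

/-- The space `G⁽ⁿ⁾` of the nerve, for `ι = {0, …, n}`: functors to `G` from the pair groupoid on
`ι`. The arrow `c i j` has source the `j`-th vertex and range the `i`-th vertex, and the units
`c i i` are the vertices. A composable string `(g₁, …, gₙ)` is recorded by `gₖ = c (k-1) k`, so
that `c i j = gᵢ₊₁ ⋯ gⱼ` for `i < j`. -/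
abbrev Nerve (G : Type u) [GroupoidStr G] (ι : Type) : Type u :=
  {c : ι → ι → G // ∀ i j k, ∃ e : src (c i j) = rng (c j k), mul (c i j) (c j k) e = c i k}

namespace Nerve

variable {G : Type u} [GroupoidStr G] {ι κ : Type}

theorem diag (c : Nerve G ι) (i j : ι) : c.1 j j = src (c.1 i j) := by
  obtain ⟨e, h⟩ := c.2 i j j
  exact eq_src_of_mul_eq_self e h

theorem rng_diag (c : Nerve G ι) (j : ι) : rng (c.1 j j) = c.1 j j := by
  rw [c.diag j j, rng_src]

theorem rng_arrow (c : Nerve G ι) (i j : ι) : rng (c.1 i j) = c.1 i i := by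
  obtain ⟨e, -⟩ := c.2 i i j
  rw [← e, ← c.diag i i]

theorem eq_star (c : Nerve G ι) (l i k : ι) (e : src (inv (c.1 l i)) = rng (c.1 l k)) :
    c.1 i k = mul (inv (c.1 l i)) (c.1 l k) e := by
  obtain ⟨e', h⟩ := c.2 l i k
  rw [← inv_mul_cancel_left e' ((src_inv _).trans (rng_mul _ _ _).symm)]
  exact mul_congr _ _ rfl h

/-- A point of the nerve is determined by the arrows ending at one vertex. -/
theorem ext_of_vertex {c c' : Nerve G ι} (l : ι) (h : ∀ k, c.1 l k = c'.1 l k) : c = c' := by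
  apply Subtype.ext
  funext i k
  rw [c.eq_star l i k (by rw [src_inv, rng_arrow, rng_arrow]),
    c'.eq_star l i k (by rw [src_inv, rng_arrow, rng_arrow])]
  exact mul_congr _ _ (by rw [h]) (h k)

/-- The point of the nerve with `c i k = (a i)⁻¹ a k`, for arrows `a k` with a common range. -/
def star (a : ι → G) (ha : ∀ i k, rng (a i) = rng (a k)) : Nerve G ι :=
  ⟨fun i k => mul (inv (a i)) (a k) ((src_inv _).trans (ha i k)), fun i j k => by
    refine ⟨by rw [src_mul, rng_mul, rng_inv], ?_⟩
    rw [mul_assoc _ _ _ ((src_inv _).trans (ha i j)) (by rw [rng_mul, rng_inv])]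
    exact mul_congr _ _ rfl (mul_inv_cancel_left _ _)⟩

theorem star_unit (a : ι → G) (ha : ∀ i k, rng (a i) = rng (a k)) (l : ι) (hl : rng (a l) = a l)
    (k : ι) : (star a ha).1 l k = a k := by
  have hi : inv (a l) = a l := by
    have h1 := mul_inv_self (a l)
    rwa [unit_mul hl, hl] at h1
  change mul (inv (a l)) (a k) _ = a k
  exact unit_mul (by rw [hi, hl]) _

/-- Reindexing of vertices. For `θ` the map that omits the value `i`, this is the face map `dᵢ`;
for `θ` the surjection that repeats the value `j`, this is the degeneracy map `sⱼ`. -/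
def map (θ : κ → ι) (c : Nerve G ι) : Nerve G κ :=
  ⟨fun i j => c.1 (θ i) (θ j), fun i j k => c.2 (θ i) (θ j) (θ k)⟩

/-- The vertex map to the unit space. -/
def vertex (l : ι) (c : Nerve G ι) : Units G := ⟨c.1 l l, c.rng_diag l⟩

variable [TopologicalSpace G]

theorem continuous_arrow (i j : ι) : Continuous fun c : Nerve G ι => c.1 i j :=
  (continuous_apply_apply i j).comp continuous_subtype_val

theorem continuous_map (θ : κ → ι) : Continuous (map θ : Nerve G ι → Nerve G κ) :=
  Continuous.subtype_mk (continuous_pi fun _ => continuous_pi fun _ => continuous_arrow _ _) _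

end Nerve

namespace IsEtale

variable {G : Type u} [TopologicalSpace G] [GroupoidStr G] [IsEtale G]

theorem continuous_rng : Continuous (rng : G → G) :=
  continuous_subtype_val.comp (isLocalHomeomorph_rng (G := G)).continuous

theorem continuous_src : Continuous (src : G → G) := by
  have : (src : G → G) = rng ∘ inv := funext fun g => (rng_inv g).symm
  rw [this]
  exact continuous_rng.comp continuous_inv

theorem continuous_mul_comp {X : Type*} [TopologicalSpace X] {a b : X → G} (ha : Continuous a)
    (hb : Continuous b) (e : ∀ x, src (a x) = rng (b x)) :
    Continuous fun x => mul (a x) (b x) (e x) :=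
  (continuous_mul (G := G)).comp
    (f := fun x => (⟨(a x, b x), e x⟩ : {p : G × G // src p.1 = rng p.2}))
    ((ha.prodMk hb).subtype_mk _)

theorem continuous_star {X : Type*} [TopologicalSpace X] {ι : Type} {a : X → ι → G}
    (ha : Continuous a) (h : ∀ x i k, rng (a x i) = rng (a x k)) :
    Continuous fun x => Nerve.star (a x) (h x) :=
  Continuous.subtype_mk (continuous_pi fun i => continuous_pi fun k =>
    continuous_mul_comp (continuous_inv.comp ((continuous_apply i).comp ha))
      ((continuous_apply k).comp ha) _) _

theorem isLocalHomeomorph_vertex {ι : Type} [Finite ι] (l : ι) :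
    IsLocalHomeomorph (Nerve.vertex l : Nerve G ι → Units G) := by
  classical
  refine IsLocalHomeomorph.mk _ fun c => ?_
  choose e he1 he2 using fun k : ι => isLocalHomeomorph_rng (G := G) (c.1 l k)
  have hr (k : ι) (g : G) : ((e k g : Units G) : G) = rng g := by
    rw [← he2 k]
  have hrs (k : ι) (x : Units G) (hx : x ∈ (e k).target) : rng ((e k).symm x) = x := by
    rw [← hr k, (e k).right_inv hx]
  let V : Set (Units G) := ⋂ k, (e k).target
  have hV : IsOpen V := isOpen_iInter_of_finite fun k => (e k).open_target
  let a : V → ι → G := fun x k => if k = l then x.1.1 else (e k).symm x.1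
  have har (x : V) (k : ι) : rng (a x k) = x.1 := by
    by_cases hk : k = l
    · simp only [a, hk, if_true]; exact x.1.2
    · simp only [a, hk, if_false]; exact hrs k x.1 (mem_iInter.1 x.2 k)
  have ha (x : V) (i k : ι) : rng (a x i) = rng (a x k) := (har x i).trans (har x k).symm
  have hac : Continuous a := by
    refine continuous_pi fun k => ?_
    by_cases hk : k = l
    · simp only [a, hk, if_true]; fun_prop
    · simp only [a, hk, if_false]
      exact (e k).continuousOn_symm.comp_continuous continuous_subtype_val
        fun x => mem_iInter.1 x.2 k
  have hal (x : V) : a x l = x.1 := by simp [a]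
  have hstar (x : V) (k : ι) : (Nerve.star (a x) (ha x)).1 l k = a x k :=
    Nerve.star_unit _ _ l (by rw [har, hal]) k
  let O : Set (Nerve G ι) := {d | (∀ k, k ≠ l → d.1 l k ∈ (e k).source) ∧ Nerve.vertex l d ∈ V}
  have hvc : Continuous (Nerve.vertex l : Nerve G ι → Units G) :=
    (Nerve.continuous_arrow l l).subtype_mk _
  have hvr (d : Nerve G ι) (k : ι) : Nerve.vertex l d = e k (d.1 l k) :=
    Subtype.ext (by rw [hr]; exact (d.rng_arrow l k).symm)
  have hO : IsOpen O := by
    have h1 : O = (⋂ k, {d : Nerve G ι | k ≠ l → d.1 l k ∈ (e k).source}) ∩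
        Nerve.vertex l ⁻¹' V := by
      ext d; simp [O]
    rw [h1]
    refine (isOpen_iInter_of_finite fun k => ?_).inter (hV.preimage hvc)
    by_cases hk : k = l
    · simp [hk]
    · simp only [ne_eq, hk, not_false_eq_true, forall_const]
      exact (e k).open_source.preimage (Nerve.continuous_arrow l k)
  let inv' : Units G → Nerve G ι := fun x =>
    if hx : x ∈ V then Nerve.star (a ⟨x, hx⟩) (ha ⟨x, hx⟩) else c
  have hinv (x : Units G) (hx : x ∈ V) : inv' x = Nerve.star (a ⟨x, hx⟩) (ha ⟨x, hx⟩) := dif_pos hx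
  have hvi (x : Units G) (hx : x ∈ V) : Nerve.vertex l (inv' x) = x := by
    apply Subtype.ext
    change (inv' x).1 l l = x
    rw [hinv x hx, hstar, hal]
  refine ⟨{
    toFun := Nerve.vertex l
    invFun := inv'
    source := O
    target := V
    map_source' := fun d hd => hd.2
    map_target' := fun x hx => ⟨fun k hk => ?_, ?_⟩
    left_inv' := fun d hd => ?_
    right_inv' := fun x hx => hvi x hx
    open_source := hO
    open_target := hV
    continuousOn_toFun := hvc.continuousOn
    continuousOn_invFun := ?_ }, ?_, fun _ _ => rfl⟩
  · rw [hinv x hx, hstar]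
    simp only [a, hk, if_false]
    exact (e k).map_target (mem_iInter.1 hx k)
  · rw [hvi x hx]; exact hx
  · rw [hinv _ hd.2]
    apply Nerve.ext_of_vertex l
    intro k
    rw [hstar]
    by_cases hk : k = l
    · subst hk; simp only [a, if_true]; rfl
    · simp only [a, hk, if_false]
      rw [hvr d k, (e k).left_inv (hd.1 k hk)]
  · rw [continuousOn_iff_continuous_domRestrict]
    have : V.domRestrict inv' = fun x : V => Nerve.star (a x) (ha x) := funext fun x => hinv x x.2
    rw [this]
    exact continuous_star hac ha
  · refine ⟨fun k _ => he1 k, mem_iInter.2 fun k => ?_⟩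
    rw [hvr c k]
    exact (e k).map_source (he1 k)

theorem isLocalHomeomorph_map {ι κ : Type} [Finite ι] [Finite κ] [Nonempty κ] (θ : κ → ι) :
    IsLocalHomeomorph (Nerve.map θ : Nerve G ι → Nerve G κ) := by
  obtain ⟨l⟩ := ‹Nonempty κ›
  exact IsLocalHomeomorph.of_comp (g := Nerve.vertex l)
    (show IsLocalHomeomorph (Nerve.vertex (G := G) (θ l)) from isLocalHomeomorph_vertex _)
    (isLocalHomeomorph_vertex l) (Nerve.continuous_map θ)

end IsEtale

/-! ### Points of the nerve are composable strings -/

/-- Composable strings `(g₁, …, gₙ₊₁)` of `n + 1` arrows. -/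
abbrev ComposableStrings (G : Type u) [GroupoidStr G] (n : ℕ) : Type u :=
  {g : Fin (n + 1) → G // ∀ i : Fin n, src (g i.castSucc) = rng (g i.succ)}

namespace ComposableStrings

variable {G : Type u} [GroupoidStr G] {n : ℕ}

/-- The products `g₁ ⋯ gₖ`, with the value `r(g₁)` for `k = 0`. -/
def prods (g : ComposableStrings G n) (k : Fin (n + 2)) :
    {x : G // rng x = rng (g.1 0) ∧ ∀ i : Fin (n + 1), i.castSucc = k → src x = rng (g.1 i)} :=
  Fin.induction (motive := fun k => {x : G // rng x = rng (g.1 0) ∧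
      ∀ i : Fin (n + 1), i.castSucc = k → src x = rng (g.1 i)})
    ⟨rng (g.1 0), rng_rng _, fun i hi => by
      rw [src_rng, show i = 0 from Fin.castSucc_injective _ (by simpa using hi)]⟩
    (fun k x => ⟨mul x.1 (g.1 k) (x.2.2 k rfl), by rw [rng_mul, x.2.1], fun i hi => by
      rw [src_mul]
      obtain ⟨j, rfl⟩ : ∃ j : Fin n, j.castSucc = k :=
        ⟨⟨k, by have := congrArg Fin.val hi; have := i.2; simp at *; omega⟩, rfl⟩
      rw [g.2 j, show i = j.succ from Fin.ext (by simpa using congrArg Fin.val hi)]⟩) k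

theorem prods_succ (g : ComposableStrings G n) (k : Fin (n + 1)) :
    (g.prods k.succ).1 = mul (g.prods k.castSucc).1 (g.1 k) ((g.prods k.castSucc).2.2 k rfl) := by
  unfold prods
  rw [Fin.induction_succ]

/-- The point of the nerve with `c i j = gᵢ₊₁ ⋯ gⱼ` for `i < j`. -/
def toNerve (g : ComposableStrings G n) : Nerve G (Fin (n + 2)) :=
  Nerve.star (fun k => (g.prods k).1) fun i k => (g.prods i).2.1.trans (g.prods k).2.1.symm

end ComposableStrings

namespace Nerve

variable {G : Type u} [GroupoidStr G] {n : ℕ}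

/-- The string of the arrows `c k (k + 1)`. -/
def toStrings (c : Nerve G (Fin (n + 2))) : ComposableStrings G n :=
  ⟨fun k => c.1 k.castSucc k.succ, fun i => (c.2 i.castSucc.castSucc i.castSucc.succ i.succ.succ).1⟩

theorem prods_toStrings (c : Nerve G (Fin (n + 2))) (k : Fin (n + 2)) :
    (c.toStrings.prods k).1 = c.1 0 k := by
  induction k using Fin.induction with
  | zero => exact c.rng_arrow 0 (Fin.succ 0)
  | succ k ih =>
    rw [ComposableStrings.prods_succ]
    obtain ⟨e, h⟩ := c.2 0 k.castSucc k.succ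
    rw [← h]
    exact mul_congr _ _ ih rfl

/-- For `n ≥ 1`, the space `G⁽ⁿ⁾` is the space of composable strings of `n` arrows. -/
def homeomorphStrings [TopologicalSpace G] [IsEtale G] :
    Nerve G (Fin (n + 2)) ≃ₜ ComposableStrings G n where
  toFun := toStrings
  invFun := ComposableStrings.toNerve
  left_inv c := by
    refine ext_of_vertex 0 fun k => ?_
    refine (star_unit _ _ 0 ?_ k).trans (c.prods_toStrings k)
    change rng (c.toStrings.prods 0).1 = (c.toStrings.prods 0).1
    rw [prods_toStrings, c.rng_diag]
  right_inv g := by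
    apply Subtype.ext
    funext k
    change mul (inv (g.prods k.castSucc).1) (g.prods k.succ).1 _ = g.1 k
    refine (mul_congr _ ?_ rfl (g.prods_succ k)).trans (inv_mul_cancel_left _ ?_) <;>
      rw [src_inv, rng_mul]
  continuous_toFun := Continuous.subtype_mk (continuous_pi fun k => continuous_arrow _ _) _
  continuous_invFun := by
    refine IsEtale.continuous_star (continuous_pi fun k => ?_) _
    induction k using Fin.induction with
    | zero =>
      exact (IsEtale.continuous_rng (G := G)).comp
        ((continuous_apply (0 : Fin (n + 1))).comp continuous_subtype_val)
    | succ k ih =>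
      simp only [ComposableStrings.prods_succ]
      exact IsEtale.continuous_mul_comp ih ((continuous_apply k).comp continuous_subtype_val) _

/-- The space `G⁽⁰⁾` is the unit space. -/
def homeomorphUnits [TopologicalSpace G] [IsEtale G] : Nerve G (Fin 1) ≃ₜ Units G where
  toFun := vertex 0
  invFun x := star (fun _ => x.1) fun _ _ => rfl
  left_inv c := ext_of_vertex 0 fun k => by
    rw [Subsingleton.elim k 0]
    exact star_unit (fun _ => c.1 0 0) (fun _ _ => rfl) 0 (c.rng_diag 0) 0
  right_inv x := Subtype.ext (star_unit (fun _ : Fin 1 => x.1) (fun _ _ => rfl) 0 x.2 0)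
  continuous_toFun := (continuous_arrow 0 0).subtype_mk _
  continuous_invFun := IsEtale.continuous_star (by fun_prop) _

/-- In terms of strings, `d₀` drops the first arrow, the last face map drops the last arrow, and
the other `dᵢ` multiply two neighbouring arrows. -/
theorem toStrings_face (c : Nerve G (Fin (n + 3))) (i : Fin (n + 3)) (k : Fin (n + 1)) :
    ((k : ℕ) + 1 < i → (map i.succAbove c).toStrings.1 k = c.toStrings.1 k.castSucc) ∧
    ((k : ℕ) + 1 = i → (map i.succAbove c).toStrings.1 k =
      mul (c.toStrings.1 k.castSucc) (c.toStrings.1 k.succ) (c.toStrings.2 k)) ∧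
    ((i : ℕ) < k + 1 → (map i.succAbove c).toStrings.1 k = c.toStrings.1 k.succ) := by
  have key (a b : Fin (n + 3)) (ha : i.succAbove k.castSucc = a) (hb : i.succAbove k.succ = b) :
      (map i.succAbove c).toStrings.1 k = c.1 a b := by rw [← ha, ← hb]; rfl
  refine ⟨fun h => ?_, fun h => ?_, fun h => ?_⟩
  · refine key _ _ (Fin.succAbove_of_castSucc_lt _ _ ?_) (Fin.succAbove_of_castSucc_lt _ _ ?_) <;>
      simp [Fin.lt_def] <;> omega
  · refine (key k.castSucc.castSucc k.succ.succ (Fin.succAbove_of_castSucc_lt _ _ ?_)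
      (Fin.succAbove_of_le_castSucc _ _ ?_)).trans
      (c.2 k.castSucc.castSucc k.castSucc.succ k.succ.succ).2.symm
    · simp [Fin.lt_def]; omega
    · simp [Fin.le_def]; omega
  · refine key _ _ (Fin.succAbove_of_le_castSucc _ _ ?_) (Fin.succAbove_of_le_castSucc _ _ ?_) <;>
      simp [Fin.le_def] <;> omega

end Nerve

/-- `(p_* f)(y) = ∑_{p x = y} f x`. -/
noncomputable def fibreSum {X Y A : Type*} [AddCommMonoid A] (p : X → Y) (f : X → A) (y : Y) : A :=
  ∑ᶠ x : p ⁻¹' {y}, f x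

theorem fibreSum_eq_sum {X Y A : Type*} [AddCommMonoid A] (p : X → Y) (f : X → A) (y : Y)
    (F : Finset X) (hF : ∀ x ∈ F, p x = y) (h : ∀ x, p x = y → f x ≠ 0 → x ∈ F) :
    fibreSum p f y = ∑ x ∈ F, f x := by
  classical
  unfold fibreSum
  rw [finsum_eq_sum_of_support_subset (s := F.subtype (· ∈ p ⁻¹' {y}))]
  · exact Finset.sum_subtype_of_mem f hF
  · intro x hx
    simpa using h x.1 x.2 hx

theorem finite_fibre {X Y : Type*} [TopologicalSpace X] [TopologicalSpace Y] [T2Space Y]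
    {A : Type v} [AddCommGroup A] [TopologicalSpace A]
    {p : X → Y} (hp : IsLocalHomeomorph p) (f : C_c(X, A)) (y : Y) :
    {x | p x = y ∧ f x ≠ 0}.Finite := by
  have hK : IsCompact (tsupport f ∩ p ⁻¹' {y}) :=
    f.hasCompactSupport.isCompact.inter_right (isClosed_singleton.preimage hp.continuous)
  refine Set.Finite.subset (hK.finite ?_) fun x hx => ⟨subset_tsupport _ hx.2, hx.1⟩
  refine ⟨?_⟩
  rw [discreteTopology_iff_isOpen_singleton]
  rintro ⟨x, hx⟩
  obtain ⟨U, hU, hxU, hinj⟩ := hp.isLocallyInjective x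
  refine ⟨U, hU, ?_⟩
  ext ⟨z, hz⟩
  simp only [mem_preimage, mem_singleton_iff, Subtype.mk.injEq]
  refine ⟨fun h => hinj h hxU (hz.2.trans hx.2.symm), fun h => h ▸ hxU⟩

section Functions

variable {X Y Z : Type*} [TopologicalSpace X] [TopologicalSpace Y] [TopologicalSpace Z]
  {A : Type v} [AddCommGroup A] [TopologicalSpace A] [DiscreteTopology A]

theorem fibreSum_eventually_eq [T2Space X] [T2Space Y] {p : X → Y} (hp : IsLocalHomeomorph p)
    (f : C_c(X, A)) (y : Y) : ∀ᶠ y' in 𝓝 y, fibreSum p f y' = fibreSum p f y := by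
  classical
  have hF := finite_fibre hp f y
  obtain ⟨U, hU, hdisj⟩ := hF.t2_separation
  have hloc : IsLocallyConstant f := (IsLocallyConstant.iff_continuous _).2 f.continuous
  have hW : ∀ x : X, ∃ W : Set X, IsOpen W ∧ x ∈ W ∧ InjOn p W ∧ W ⊆ U x ∧
      ∀ z ∈ W, f z = f x := by
    intro x
    obtain ⟨W, hW, hxW, hinj⟩ := hp.isLocallyInjective x
    refine ⟨W ∩ U x ∩ f ⁻¹' {f x}, (hW.inter (hU x).2).inter (hloc _), ⟨⟨hxW, (hU x).1⟩, rfl⟩,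
      hinj.mono fun z hz => hz.1.1, fun z hz => hz.1.2, fun z hz => hz.2⟩
  choose W hWo hxW hWinj hWU hWf using hW
  have h1 : ∀ᶠ y' in 𝓝 y, ∀ x ∈ hF.toFinset, y' ∈ p '' W x := by
    rw [Filter.eventually_all_finset]
    intro x hx
    have hx' : p x = y := ((hF.mem_toFinset).1 hx).1
    exact hx' ▸ (hp.isOpenMap _ (hWo x)).mem_nhds ⟨x, hxW x, rfl⟩
  let R : Set X := tsupport f \ ((⋃ x ∈ hF.toFinset, W x) ∪ f ⁻¹' {0})
  have hR : IsCompact R := f.hasCompactSupport.isCompact.diff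
    ((isOpen_biUnion fun x _ => hWo x).union (hloc _))
  have h2 : ∀ᶠ y' in 𝓝 y, y' ∈ (p '' R)ᶜ := by
    refine (hR.image hp.continuous).isClosed.isOpen_compl.mem_nhds ?_
    rintro ⟨x, ⟨-, hx⟩, hxy⟩
    refine hx ?_
    by_cases h0 : f x = 0
    · exact Or.inr h0
    · exact Or.inl (mem_biUnion (hF.mem_toFinset.2 ⟨hxy, h0⟩) (hxW x))
  filter_upwards [h1, h2] with y' hy1 hy2
  choose! σ hσ using hy1
  have hinj : InjOn σ hF.toFinset := by
    intro a ha b hb hab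
    by_contra hne
    have hd := hdisj ((hF.mem_toFinset).1 ha) ((hF.mem_toFinset).1 hb) hne
    exact Set.disjoint_left.1 hd (hWU a (hσ a ha).1) (hab ▸ hWU b (hσ b hb).1)
  rw [fibreSum_eq_sum p f y' (hF.toFinset.image σ), fibreSum_eq_sum p f y hF.toFinset,
    Finset.sum_image hinj]
  · exact Finset.sum_congr rfl fun x hx => hWf x _ (hσ x hx).1
  · exact fun x hx => ((hF.mem_toFinset).1 hx).1
  · exact fun x hx h0 => (hF.mem_toFinset).2 ⟨hx, h0⟩
  · intro x hx
    obtain ⟨a, ha, rfl⟩ := Finset.mem_image.1 hx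
    exact (hσ a ha).2
  · intro x hx h0
    have hxR : x ∉ R := fun h => hy2 ⟨x, h, hx⟩
    have hx' : x ∈ ⋃ x ∈ hF.toFinset, W x := by
      by_contra hc
      exact hxR ⟨subset_tsupport _ h0, fun h => h.elim hc h0⟩
    obtain ⟨a, ha, hxa⟩ := mem_iUnion₂.1 hx'
    refine Finset.mem_image.2 ⟨a, ha, ?_⟩
    exact hWinj a (hσ a ha).1 hxa ((hσ a ha).2.trans hx.symm)

/-- The pushforward `p_* : C_c(X, A) → C_c(Y, A)` along a local homeomorphism. -/
noncomputable def pushforward (A : Type v) [AddCommGroup A] [TopologicalSpace A]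
    [DiscreteTopology A] [T2Space X] [T2Space Y] (p : X → Y) (hp : IsLocalHomeomorph p) :
    C_c(X, A) →+ C_c(Y, A) where
  toFun f :=
    { toFun := fibreSum p f
      continuous_toFun := continuous_iff_continuousAt.2 fun y =>
        tendsto_nhds_of_eventually_eq (fibreSum_eventually_eq hp f y)
      hasCompactSupport' := by
        refine HasCompactSupport.intro (f.hasCompactSupport.isCompact.image hp.continuous) ?_
        intro y hy
        rw [fibreSum_eq_sum p f y ∅ (by simp) ?_, Finset.sum_empty]
        exact fun x hx h0 => (hy ⟨x, subset_tsupport _ h0, hx⟩).elim }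
  map_zero' := by
    ext y
    exact fibreSum_eq_sum p _ y ∅ (by simp) fun x _ h => (h rfl).elim
  map_add' f g := by
    classical
    ext y
    let F := (finite_fibre hp f y).toFinset ∪ (finite_fibre hp g y).toFinset
    have hF : ∀ x ∈ F, p x = y := by
      intro x hx
      simp only [F, Finset.mem_union, Finite.mem_toFinset, mem_ofPred_eq] at hx
      exact hx.elim And.left And.left
    have key : ∀ h : X → A, (∀ x, h x ≠ 0 → f x ≠ 0 ∨ g x ≠ 0) →
        fibreSum p h y = ∑ x ∈ F, h x := by
      intro h hh
      refine fibreSum_eq_sum p h y F hF fun x hx h0 => ?_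
      simp only [F, Finset.mem_union, Finite.mem_toFinset, mem_ofPred_eq]
      exact (hh x h0).imp (fun h => ⟨hx, h⟩) fun h => ⟨hx, h⟩
    change fibreSum p (fun x => f x + g x) y = fibreSum p f y + fibreSum p g y
    rw [key _ ?_, key f fun x h => Or.inl h, key g fun x h => Or.inr h, Finset.sum_add_distrib]
    intro x h
    by_contra! hc
    exact h (by simp [hc.1, hc.2])

theorem pushforward_apply [T2Space X] [T2Space Y] (p : X → Y) (hp : IsLocalHomeomorph p)
    (f : C_c(X, A)) (y : Y) : pushforward A p hp f y = ∑ᶠ x : p ⁻¹' {y}, f x := rfl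

theorem pushforward_id [T2Space X] (hp : IsLocalHomeomorph (fun x : X => x)) (f : C_c(X, A)) :
    pushforward A (fun x : X => x) hp f = f := by
  ext y
  exact (fibreSum_eq_sum _ f y {y} (by simp) (by simp +contextual)).trans (by simp)

theorem pushforward_comp [T2Space X] [T2Space Y] [T2Space Z] (p : X → Y) (q : Y → Z)
    (hp : IsLocalHomeomorph p) (hq : IsLocalHomeomorph q) (h : IsLocalHomeomorph fun x => q (p x))
    (f : C_c(X, A)) :
    pushforward A (fun x => q (p x)) h f = pushforward A q hq (pushforward A p hp f) := by
  classical
  ext z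
  let F := (finite_fibre h f z).toFinset
  have hF : ∀ x, x ∈ F ↔ q (p x) = z ∧ f x ≠ 0 := fun x => by simp [F]
  have h1 : fibreSum (fun x => q (p x)) f z = ∑ x ∈ F, f x :=
    fibreSum_eq_sum _ f z F (fun x hx => ((hF x).1 hx).1) fun x hx h0 => (hF x).2 ⟨hx, h0⟩
  have h2 : ∀ y, q y = z → fibreSum p f y = ∑ x ∈ F with p x = y, f x := by
    intro y hy
    refine fibreSum_eq_sum p f y _ (fun x hx => (Finset.mem_filter.1 hx).2) fun x hx h0 => ?_
    exact Finset.mem_filter.2 ⟨(hF x).2 ⟨by rw [hx, hy], h0⟩, hx⟩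
  have h3 : fibreSum q (fibreSum p f) z = ∑ y ∈ F.image p, fibreSum p f y := by
    refine fibreSum_eq_sum q _ z _ (fun y hy => ?_) fun y hy h0 => ?_
    · obtain ⟨x, hx, rfl⟩ := Finset.mem_image.1 hy
      exact ((hF x).1 hx).1
    · by_contra hc
      refine h0 ?_
      rw [h2 y hy]
      refine Finset.sum_eq_zero fun x hx => ?_
      exact (hc (Finset.mem_image.2 ⟨x, (Finset.mem_filter.1 hx).1, (Finset.mem_filter.1 hx).2⟩)).elim
  change fibreSum (fun x => q (p x)) f z = fibreSum q (fibreSum p f) z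
  rw [h1, h3, ← Finset.sum_fiberwise_of_maps_to (t := F.image p)
    fun x hx => Finset.mem_image_of_mem p hx]
  refine Finset.sum_congr rfl fun y hy => (h2 y ?_).symm
  obtain ⟨x, hx, rfl⟩ := Finset.mem_image.1 hy
  exact ((hF x).1 hx).1

/-- The pullback `q^* : C_c(Y, A) → C_c(X, A)`, `q^* f = f ∘ q`, along a proper map. -/
noncomputable def pullback (A : Type v) [AddCommGroup A] [TopologicalSpace A]
    [DiscreteTopology A] [T2Space X] (q : X → Y) (hq : IsProperMap q) :
    C_c(Y, A) →+ C_c(X, A) where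
  toFun f :=
    { toFun := fun x => f (q x)
      continuous_toFun := f.continuous.comp hq.continuous
      hasCompactSupport' :=
        HasCompactSupport.intro (hq.isCompact_preimage f.hasCompactSupport.isCompact)
          fun _ hx => image_eq_zero_of_notMem_tsupport hx }
  map_zero' := rfl
  map_add' _ _ := rfl

theorem pullback_pushforward {X' Y' : Type*} [TopologicalSpace X'] [TopologicalSpace Y']
    [T2Space X] [T2Space Y] [T2Space X'] [T2Space Y']
    (p : X → Y) (hp : IsLocalHomeomorph p) (p' : X' → Y') (hp' : IsLocalHomeomorph p')
    (q : X → X') (hq : IsProperMap q) (r : Y → Y') (hr : IsProperMap r)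
    (hqr : ∀ x, p' (q x) = r (p x))
    (hfib : ∀ y x', p' x' = r y → ∃! x, p x = y ∧ q x = x') (f : C_c(X', A)) :
    pullback A r hr (pushforward A p' hp' f) = pushforward A p hp (pullback A q hq f) := by
  classical
  ext y
  change fibreSum p' f (r y) = fibreSum p (fun x => f (q x)) y
  let F := (finite_fibre hp (pullback A q hq f) y).toFinset
  have hF : ∀ x, x ∈ F ↔ p x = y ∧ f (q x) ≠ 0 := fun x => Set.Finite.mem_toFinset _
  rw [fibreSum_eq_sum p _ y F (fun x hx => ((hF x).1 hx).1) fun x hx h0 => (hF x).2 ⟨hx, h0⟩,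
    fibreSum_eq_sum p' f (r y) (F.image q), Finset.sum_image]
  · intro a ha b hb hab
    have ha1 := ((hF a).1 ha).1
    have hb1 := ((hF b).1 hb).1
    exact (hfib y (q a) (by rw [hqr, ha1])).unique ⟨ha1, rfl⟩ ⟨hb1, hab.symm⟩
  · intro x' hx'
    obtain ⟨x, hx, rfl⟩ := Finset.mem_image.1 hx'
    rw [hqr, ((hF x).1 hx).1]
  · intro x' hx' h0
    obtain ⟨x, ⟨hx1, rfl⟩, -⟩ := hfib y x' hx'
    exact Finset.mem_image.2 ⟨x, (hF x).2 ⟨hx1, h0⟩, rfl⟩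

end Functions

/-! ### The chain complex of an étale groupoid -/

section Homology

variable (G : Type u) [TopologicalSpace G] [GroupoidStr G] [IsEtale G]
  (A : Type v) [AddCommGroup A] [TopologicalSpace A] [DiscreteTopology A]

/-- The simplicial abelian group `C_c(G⁽ⁿ⁾, A)`. -/
noncomputable def nerveFunctions : SimplicialObject AddCommGrpCat.{max u v} where
  obj n := AddCommGrpCat.of C_c(Nerve G (Fin (n.unop.len + 1)), A)
  map θ := AddCommGrpCat.ofHom
    (pushforward A (Nerve.map θ.unop.toOrderHom) (IsEtale.isLocalHomeomorph_map _))
  map_id n := by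
    ext1
    exact AddMonoidHom.ext fun f => pushforward_id (IsEtale.isLocalHomeomorph_map id) f
  map_comp θ η := by
    ext1
    exact AddMonoidHom.ext fun f => pushforward_comp (Nerve.map θ.unop.toOrderHom)
      (Nerve.map η.unop.toOrderHom) (IsEtale.isLocalHomeomorph_map _)
      (IsEtale.isLocalHomeomorph_map _) (IsEtale.isLocalHomeomorph_map _) f

/-- The Moore complex `C(G, A)`, with `∂ₙ = ∑ᵢ (-1)ⁱ dᵢ_*`. -/
noncomputable def chains : ChainComplex AddCommGrpCat.{max u v} ℕ :=
  (AlgebraicTopology.alternatingFaceMapComplex AddCommGrpCat.{max u v}).obj (nerveFunctions G A)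

/-- `Hₙ(G, A)`. -/
noncomputable abbrev groupoidHomology (n : ℕ) : AddCommGrpCat.{max u v} := (chains G A).homology n

end Homology

/-! ### Factor groupoids -/

/-- A continuous proper surjective homomorphism of groupoids that restricts to bijections between
range fibres. (`IsProperMap` includes continuity.) -/
structure FactorMap (G G' : Type u) [TopologicalSpace G] [TopologicalSpace G'] [GroupoidStr G]
    [GroupoidStr G'] where
  toFun : G → G'
  map_rng : ∀ g, toFun (rng g) = rng (toFun g)
  map_src : ∀ g, toFun (src g) = src (toFun g)
  map_mul : ∀ g h (e : src g = rng h),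
    toFun (mul g h e) = mul (toFun g) (toFun h) (by rw [← map_src, ← map_rng, e])
  isProperMap : IsProperMap toFun
  surjective : Function.Surjective toFun
  bijOn_fibre : ∀ x ∈ Units G, BijOn toFun {g | rng g = x} {g' | rng g' = toFun x}

namespace FactorMap

variable {G G' : Type u}

section Basic
variable [TopologicalSpace G] [TopologicalSpace G'] [GroupoidStr G] [GroupoidStr G']
  (π : FactorMap G G')

instance : CoeFun (FactorMap G G') fun _ => G → G' := ⟨FactorMap.toFun⟩

theorem injOn_fibre {g h : G} (hr : rng g = rng h) (hp : π g = π h) : g = h :=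
  (π.bijOn_fibre (rng g) (rng_rng g)).injOn rfl hr.symm hp

theorem exists_lift {x : G} (hx : rng x = x) (g' : G') (h : rng g' = π x) :
    ∃ g, rng g = x ∧ π g = g' :=
  (π.bijOn_fibre x hx).surjOn h

theorem map_inv (g : G) : π (inv g) = inv (π g) := by
  refine mul_left_cancel (g := π g) ?_ (rng_inv _).symm ?_
  · rw [← π.map_src, ← π.map_rng, rng_inv]
  · rw [mul_inv_self, ← π.map_mul g (inv g) (rng_inv g).symm, mul_inv_self, π.map_rng]

/-- The induced map `π⁽ⁿ⁾` between nerves. -/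
def nerveMap {ι : Type} (c : Nerve G ι) : Nerve G' ι :=
  ⟨fun i j => π (c.1 i j), fun i j k => by
    obtain ⟨e, h⟩ := c.2 i j k
    exact ⟨by rw [← π.map_src, ← π.map_rng, e], (π.map_mul _ _ e).symm.trans (congrArg π.toFun h)⟩⟩

theorem nerve_lift {ι κ : Type} [Nonempty κ] (θ : κ → ι) (y : Nerve G κ) (c' : Nerve G' ι)
    (h : Nerve.map θ c' = π.nerveMap y) : ∃! c, Nerve.map θ c = y ∧ π.nerveMap c = c' := by
  obtain ⟨l⟩ := ‹Nonempty κ›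
  have hy (i j : κ) : c'.1 (θ i) (θ j) = π (y.1 i j) := congrFun (congrFun (congrArg Subtype.val h) i) j
  choose a ha1 ha2 using fun k : ι => π.exists_lift (y.rng_diag l) (c'.1 (θ l) k)
    (by rw [c'.rng_arrow, hy])
  have hal : a (θ l) = y.1 l l :=
    π.injOn_fibre (by rw [ha1, y.rng_diag]) (by rw [ha2, hy])
  have hst (k : ι) := Nerve.star_unit a (fun i k => (ha1 i).trans (ha1 k).symm) (θ l)
    (by rw [hal, y.rng_diag]) k
  refine ⟨Nerve.star a fun i k => (ha1 i).trans (ha1 k).symm, ⟨?_, ?_⟩, ?_⟩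
  · refine Nerve.ext_of_vertex l fun k => ?_
    refine (hst (θ k)).trans (π.injOn_fibre ?_ ?_)
    · rw [ha1, y.rng_arrow]
    · rw [ha2, hy]
  · refine Nerve.ext_of_vertex (θ l) fun k => ?_
    exact (congrArg π (hst k)).trans (ha2 k)
  · rintro c ⟨hc1, hc2⟩
    refine Nerve.ext_of_vertex (θ l) fun k => ?_
    rw [hst k]
    have h1 : c.1 (θ l) (θ l) = y.1 l l := congrFun (congrFun (congrArg Subtype.val hc1) l) l
    have h2 : π (c.1 (θ l) k) = c'.1 (θ l) k :=
      congrFun (congrFun (congrArg Subtype.val hc2) (θ l)) k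
    refine π.injOn_fibre ?_ ?_
    · rw [c.rng_arrow, ha1, h1]
    · rw [h2, ha2]

theorem isClosed_nerve (G : Type u) [TopologicalSpace G] [GroupoidStr G] [IsEtale G] (ι : Type) :
    IsClosed {c : ι → ι → G | ∀ i j k, ∃ e : src (c i j) = rng (c j k),
      mul (c i j) (c j k) e = c i k} := by
  have hZ : IsClosed {p : G × G | src p.1 = rng p.2} :=
    isClosed_eq (IsEtale.continuous_src.comp continuous_fst)
      (IsEtale.continuous_rng.comp continuous_snd)
  have hT : IsClosed {t : (G × G) × G | ∃ e : src t.1.1 = rng t.1.2, mul t.1.1 t.1.2 e = t.2} := by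
    have h1 : IsClosed {t : {p : G × G // src p.1 = rng p.2} × G |
        mul t.1.1.1 t.1.1.2 t.1.2 = t.2} :=
      isClosed_eq ((IsEtale.continuous_mul (G := G)).comp continuous_fst) continuous_snd
    have h2 := (hZ.isClosedEmbedding_subtypeVal.prodMap (.id (X := G))).isClosedMap _ h1
    convert h2 using 1
    ext ⟨⟨a, b⟩, c⟩
    simp
  simp only [ofPred_forall]
  refine isClosed_iInter fun i => isClosed_iInter fun j => isClosed_iInter fun k => ?_
  exact hT.preimage (f := fun c : ι → ι → G => ((c i j, c j k), c i k)) (by fun_prop)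

theorem isProperMap_nerveMap [IsEtale G] [IsEtale G'] (ι : Type) :
    IsProperMap (π.nerveMap : Nerve G ι → Nerve G' ι) := by
  have h1 : IsProperMap fun (c : ι → ι → G) i j => π (c i j) :=
    IsProperMap.pi_map fun _ => IsProperMap.pi_map fun _ => π.isProperMap
  have h2 := h1.comp (isClosed_nerve G ι).isClosedEmbedding_subtypeVal.isProperMap
  refine isProperMap_of_comp_of_inj ?_ continuous_subtype_val h2 Subtype.val_injective
  exact h2.continuous.subtype_mk _

end Basic

section Complexes

variable [TopologicalSpace G] [TopologicalSpace G'] [GroupoidStr G] [GroupoidStr G']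
  [IsEtale G] [IsEtale G'] (π : FactorMap G G')
  (A : Type v) [AddCommGroup A] [TopologicalSpace A] [DiscreteTopology A]

/-- The chain map `π^* : C(G', A) → C(G, A)`, `f ↦ f ∘ π⁽ⁿ⁾`. -/
noncomputable def chainMap : chains G' A ⟶ chains G A :=
  (AlgebraicTopology.alternatingFaceMapComplex AddCommGrpCat.{max u v}).map
    { app := fun n => AddCommGrpCat.ofHom (pullback A π.nerveMap
        (π.isProperMap_nerveMap (Fin (n.unop.len + 1))))
      naturality := fun m n θ => by
        ext1
        exact AddMonoidHom.ext fun f => pullback_pushforward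
          (Nerve.map θ.unop.toOrderHom) (IsEtale.isLocalHomeomorph_map _)
          (Nerve.map θ.unop.toOrderHom) (IsEtale.isLocalHomeomorph_map _)
          π.nerveMap (π.isProperMap_nerveMap _) π.nerveMap (π.isProperMap_nerveMap _)
          (fun _ => rfl)
          (fun y c' h => π.nerve_lift _ y c' h) f }

/-- The relative complex `C(G, A) / C(G', A)`. -/
noncomputable def relChains : ChainComplex AddCommGrpCat.{max u v} ℕ :=
  Limits.cokernel (π.chainMap A)

/-- The sequence of complexes `C(G', A) → C(G, A) → C(G, A) / C(G', A)`. -/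
noncomputable def chainSequence : ShortComplex (ChainComplex AddCommGrpCat.{max u v} ℕ) where
  f := π.chainMap A
  g := Limits.cokernel.π (π.chainMap A)
  zero := Limits.cokernel.condition _

/-- The class in `C_c(G⁽ⁿ⁾, A) / C_c(G'⁽ⁿ⁾, A)` of a function in `C_c(G⁽ⁿ⁾, A)`. -/
noncomputable def relClass (n : ℕ) (f : C_c(Nerve G (Fin (n + 1)), A)) : (π.relChains A).X n :=
  ((Limits.cokernel.π (π.chainMap A)).f n).hom f

/-- `Hₙ(G/G', A)`. -/
noncomputable abbrev relHomology (n : ℕ) : AddCommGrpCat.{max u v} := (π.relChains A).homology n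

/-- `π^* : Hₙ(G', A) → Hₙ(G, A)`. -/
noncomputable def homologyPullback (n : ℕ) : groupoidHomology G' A n ⟶ groupoidHomology G A n :=
  HomologicalComplex.homologyMap (π.chainMap A) n

/-- The map `Hₙ(G, A) → Hₙ(G/G', A)` induced by the quotient map of complexes. -/
noncomputable def homologyQuotient (n : ℕ) : groupoidHomology G A n ⟶ π.relHomology A n :=
  HomologicalComplex.homologyMap (Limits.cokernel.π (π.chainMap A)) n

/-- The connecting homomorphism `Hₙ₊₁(G/G', A) → Hₙ(G', A)`. -/
noncomputable def connecting (h : (π.chainSequence A).ShortExact) (n : ℕ) :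
    π.relHomology A (n + 1) ⟶ groupoidHomology G' A n :=
  h.δ (n + 1) n rfl

end Complexes

end FactorMap

/-! ### Regular maps and the groupoids `G_π → G'_π` -/

/-- Regularity of a continuous proper surjection `p : X → X'`, with the Hausdorff distance and the
diameter taken with respect to the metric of `X`. -/
def IsRegularMap {X X' : Type*} [MetricSpace X] [TopologicalSpace X'] (p : X → X') : Prop :=
  ∀ x' : X', ∀ ε : ℝ, 0 < ε → ∃ U : Set X', IsOpen U ∧ x' ∈ U ∧ ∀ y' ∈ U,
    Metric.hausdorffDist (p ⁻¹' {x'}) (p ⁻¹' {y'}) < ε ∨ Metric.diam (p ⁻¹' {y'}) < ε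

/-- The restriction of a groupoid to a set of arrows that contains an arrow if and only if it
contains its range, and if and only if it contains its inverse. -/
abbrev GroupoidStr.restrict {G : Type u} [GroupoidStr G] (P : G → Prop)
    (hr : ∀ g, P (rng g) ↔ P g) (hi : ∀ g, P (inv g) ↔ P g) : GroupoidStr {g : G // P g} where
  rng g := ⟨rng g.1, (hr _).2 g.2⟩
  src g := ⟨src g.1, by rw [← rng_inv, hr, hi]; exact g.2⟩
  inv g := ⟨inv g.1, (hi _).2 g.2⟩
  mul g h e := ⟨mul g.1 h.1 (congrArg Subtype.val e), by rw [← hr, rng_mul, hr]; exact g.2⟩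
  rng_rng _ := Subtype.ext (rng_rng _)
  src_rng _ := Subtype.ext (src_rng _)
  rng_src _ := Subtype.ext (rng_src _)
  src_src _ := Subtype.ext (src_src _)
  rng_inv _ := Subtype.ext (rng_inv _)
  src_inv _ := Subtype.ext (src_inv _)
  rng_mul _ _ _ := Subtype.ext (rng_mul _ _ _)
  src_mul _ _ _ := Subtype.ext (src_mul _ _ _)
  mul_assoc _ _ _ _ _ := Subtype.ext (mul_assoc _ _ _ _ _)
  rng_mul_self _ := Subtype.ext (rng_mul_self _)
  mul_src_self _ := Subtype.ext (mul_src_self _)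
  mul_inv_self _ := Subtype.ext (mul_inv_self _)
  inv_mul_self _ := Subtype.ext (inv_mul_self _)

namespace FactorMap

variable {G G' : Type u} [GroupoidStr G] [GroupoidStr G']

/-- The set `G'_π` of all `g'` whose fibre `π⁻¹(g')` has more than one element. -/
def Base [TopologicalSpace G] [TopologicalSpace G'] (π : FactorMap G G') : Type u :=
  {g' : G' // (π ⁻¹' {g'}).Nontrivial}

/-- The set `G_π = π⁻¹(G'_π)`. -/
def Total [TopologicalSpace G] [TopologicalSpace G'] (π : FactorMap G G') : Type u :=
  {g : G // (π ⁻¹' {π g}).Nontrivial}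

section Algebra

variable [TopologicalSpace G] [TopologicalSpace G'] (π : FactorMap G G')

/-- The restriction of `π` to a map `G_π → G'_π`. -/
def proj (g : π.Total) : π.Base := ⟨π g.1, g.2⟩

theorem nontrivial_rng (g' : G') :
    (π ⁻¹' {rng g'}).Nontrivial ↔ (π ⁻¹' {g'}).Nontrivial := by
  constructor
  · rintro ⟨x, hx, y, hy, hxy⟩
    have hu (z : G) (hz : π z = rng g') : rng z = z :=
      π.injOn_fibre (rng_rng z) (by rw [π.map_rng, hz, rng_rng])
    obtain ⟨g, hg1, hg2⟩ := π.exists_lift (hu x hx) g' hx.symm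
    obtain ⟨h, hh1, hh2⟩ := π.exists_lift (hu y hy) g' hy.symm
    exact ⟨g, hg2, h, hh2, fun h => hxy (by rw [← hg1, ← hh1, h])⟩
  · rintro ⟨x, hx, y, hy, hxy⟩
    have hx : π x = g' := hx
    have hy : π y = g' := hy
    refine ⟨rng x, ?_, rng y, ?_, fun h => hxy (π.injOn_fibre h (by rw [hx, hy]))⟩
    · rw [mem_preimage, mem_singleton_iff, π.map_rng, hx]
    · rw [mem_preimage, mem_singleton_iff, π.map_rng, hy]

theorem nontrivial_inv (g' : G') :
    (π ⁻¹' {inv g'}).Nontrivial ↔ (π ⁻¹' {g'}).Nontrivial := by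
  have key (g' : G') (h : (π ⁻¹' {g'}).Nontrivial) : (π ⁻¹' {inv g'}).Nontrivial := by
    obtain ⟨x, hx, y, hy, hxy⟩ := h
    have hx : π x = g' := hx
    have hy : π y = g' := hy
    refine ⟨inv x, ?_, inv y, ?_, fun h => hxy ?_⟩
    · rw [mem_preimage, mem_singleton_iff, π.map_inv, hx]
    · rw [mem_preimage, mem_singleton_iff, π.map_inv, hy]
    · rw [← inv_inv x, ← inv_inv y, h]
  exact ⟨fun h => by simpa [GroupoidStr.inv_inv] using key _ h, key g'⟩

instance : GroupoidStr π.Base := GroupoidStr.restrict _ π.nontrivial_rng π.nontrivial_inv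

instance : GroupoidStr π.Total := GroupoidStr.restrict _
  (fun g => by rw [π.map_rng]; exact π.nontrivial_rng _)
  (fun g => by rw [π.map_inv]; exact π.nontrivial_inv _)

end Algebra

section Metric

variable [MetricSpace G] [TopologicalSpace G'] (π : FactorMap G G')

theorem isCompact_fibre (g' : G') : IsCompact (π ⁻¹' {g'}) :=
  π.isProperMap.isCompact_preimage isCompact_singleton

theorem nonempty_fibre (g' : G') : (π ⁻¹' {g'}).Nonempty := π.surjective g'

theorem hausdorffEDist_ne_top (g' h' : G') :
    Metric.hausdorffEDist (π ⁻¹' {g'}) (π ⁻¹' {h'}) ≠ ⊤ :=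
  Metric.hausdorffEDist_ne_top_of_nonempty_of_bounded (π.nonempty_fibre g') (π.nonempty_fibre h')
    (π.isCompact_fibre g').isBounded (π.isCompact_fibre h').isBounded

/-- The metric `d'_π(g', h') = d_H(π⁻¹(g'), π⁻¹(h'))` on `G'_π`. -/
noncomputable instance : MetricSpace π.Base where
  dist g' h' := Metric.hausdorffDist (π ⁻¹' {g'.1}) (π ⁻¹' {h'.1})
  dist_self g' := Metric.hausdorffDist_self_zero
  dist_comm g' h' := Metric.hausdorffDist_comm
  dist_triangle g' h' k' := Metric.hausdorffDist_triangle (π.hausdorffEDist_ne_top _ _)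
  eq_of_dist_eq_zero {g' h'} h := by
    have h1 := (IsClosed.hausdorffDist_zero_iff_eq (π.isCompact_fibre g'.1).isClosed
      (π.isCompact_fibre h'.1).isClosed (π.hausdorffEDist_ne_top _ _)).1 h
    obtain ⟨x, hx⟩ := π.nonempty_fibre g'.1
    have hx' : x ∈ π ⁻¹' {h'.1} := h1 ▸ hx
    exact Subtype.ext (Eq.trans (Eq.symm hx) hx')

/-- The metric `d_π(g, h) = d(g, h) + d'_π(π(g), π(h))` on `G_π`. -/
noncomputable instance : MetricSpace π.Total where
  dist g h := dist g.1 h.1 + dist (π.proj g) (π.proj h)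
  dist_self g := by simp
  dist_comm g h := by rw [dist_comm g.1, dist_comm (π.proj g)]
  dist_triangle g h k := by
    linarith [dist_triangle g.1 h.1 k.1, dist_triangle (π.proj g) (π.proj h) (π.proj k)]
  eq_of_dist_eq_zero {g h} e := by
    have h1 := dist_nonneg (x := g.1) (y := h.1)
    have h2 := dist_nonneg (x := π.proj g) (y := π.proj h)
    exact Subtype.ext (dist_eq_zero.1 (by linarith : dist g.1 h.1 = 0))

/-- The inclusion `G_π⁽ⁿ⁾ → G⁽ⁿ⁾`. -/
def nerveIncl {ι : Type} (c : Nerve π.Total ι) : Nerve G ι :=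
  ⟨fun i j => (c.1 i j).1, fun i j k => by
    obtain ⟨e, h⟩ := c.2 i j k
    exact ⟨congrArg Subtype.val e, congrArg Subtype.val h⟩⟩

/-- `Φ` is the reduction: it sends the class of `f ∈ C_c(G⁽ⁿ⁾, A)` to the class of the function
`f_K ∈ C_c(G_π⁽ⁿ⁾, A)` that agrees with `f` over `K` and vanishes elsewhere, for all sufficiently
large compact open sets `K` in `G'_π⁽ⁿ⁾`. -/
def IsReduction [IsEtale G] [IsEtale G'] [IsEtale π.Total] [IsEtale π.Base]
    (ρ : FactorMap π.Total π.Base)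
    {A : Type v} [AddCommGroup A] [TopologicalSpace A] [DiscreteTopology A]
    (Φ : π.relChains A ⟶ ρ.relChains A) : Prop :=
  ∀ (n : ℕ) (f : C_c(Nerve G (Fin (n + 1)), A)),
    ∃ L : Set (Nerve π.Base (Fin (n + 1))), IsCompact L ∧ IsOpen L ∧
      ∀ K : Set (Nerve π.Base (Fin (n + 1))), IsCompact K → IsOpen K → L ⊆ K →
        ∃ fK : C_c(Nerve π.Total (Fin (n + 1)), A),
          (∀ c, ρ.nerveMap c ∈ K → fK c = f (π.nerveIncl c)) ∧
          (∀ c, ρ.nerveMap c ∉ K → fK c = 0) ∧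
          (Φ.f n).hom (π.relClass A n f) = ρ.relClass A n fK

end Metric

end FactorMap

open GroupoidStr

/-! ### The topologies of `G_π` and `G'_π` -/

namespace FactorMap

variable {G G' : Type u} [GroupoidStr G] [GroupoidStr G']

/-! The quotient complex only sees the double points of `π`. A function in `C_c(G⁽ⁿ⁾, A)` is a
pullback from `G'` exactly when it is constant on the fibres of `π⁽ⁿ⁾`. Two points of one fibre that
differ must differ in every arrow, so a fibre with more than one point lies in the nerve of `G_π`.
What remains is topology: the metrics on `G_π` and `G'_π` must be fine enough to be étale and to
make the relevant sets compact.

Regularity is used only through `continuous_offDiagMap`: the map sending a pair of distinct points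
of one fibre to their common image in `G'_π` is continuous. Near such a pair the fibres cannot have
small diameter, so they must be close in Hausdorff distance. Compact sets of pairs therefore have
compact image in `G'_π`. This gives local compactness and separability of `G'_π`, and it shows that
the fibres on which a given `f` is not constant lie over a compact set
(`exists_isCompact_nonconstant`).

The groupoid structure is handled in the coordinates (image, range). An arrow of `G` is determined
by its image in `G'` and its range, and since `π` is proper these two maps induce the topology of
`G` (`isInducing_map_rng`). The inclusion in `G'` and the range map do the same for `G'_π`
(`tendsto_base_of_rng`), and `G_π` is the fibre product of `G` and `G'_π` over `G'`
(`isClosedEmbedding_total`).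

The compact open set needed to cut off `f` depends on `f`, so the isomorphism comes from a relation
rather than from a map: `f` and `g` are related if the restriction of `f` minus `g` is constant on
the fibres over `G'_π⁽ⁿ⁾` (`reductionRel`). The relation is total by cutting off, onto by extending
from a compact set, matches the two kernels, and is preserved by the boundary. It therefore induces
an isomorphism of the quotient complexes. -/

theorem rng_unit_of_map [TopologicalSpace G] [TopologicalSpace G'] (π : FactorMap G G') {x : G}
    {g' : G'} (hx : π x = rng g') : rng x = x :=
  π.injOn_fibre (rng_rng x) (by rw [π.map_rng, hx, rng_rng])

/-- The topology of `G` is induced by `π` and the range map. -/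
theorem isInducing_map_rng [TopologicalSpace G] [TopologicalSpace G'] [IsEtale G] [IsEtale G']
    (π : FactorMap G G') : IsInducing fun g : G => (π g, rng g) := by
  have hc : Continuous fun g : G => (π g, rng g) :=
    π.isProperMap.continuous.prodMk IsEtale.continuous_rng
  -- Followed by the first projection this map is the proper map `π`. It is injective because `π` is
  -- injective on range fibres.
  have hp : IsProperMap fun g : G => (π g, rng g) :=
    isProperMap_of_comp_of_t2 hc continuous_fst π.isProperMap
  exact (IsClosedEmbedding.of_continuous_injective_isClosedMap hc
    (fun a b hab => π.injOn_fibre (congrArg Prod.snd hab) (congrArg Prod.fst hab))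
    hp.isClosedMap).isInducing

theorem tendsto_of_map_rng [TopologicalSpace G] [TopologicalSpace G'] [IsEtale G] [IsEtale G']
    (π : FactorMap G G') {Z : Type*} {l : Filter Z} {f : Z → G} {g : G}
    (h : Filter.Tendsto (fun z => π (f z)) l (𝓝 (π g)))
    (hr : Filter.Tendsto (fun z => rng (f z)) l (𝓝 (rng g))) : Filter.Tendsto f l (𝓝 g) :=
  π.isInducing_map_rng.tendsto_nhds_iff.2 (h.prodMk_nhds hr)

section Metric

variable [MetricSpace G] [TopologicalSpace G'] (π : FactorMap G G')

theorem proj_surjective : Function.Surjective π.proj := fun b => by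
  obtain ⟨g, hg⟩ := π.surjective b.1
  have hg : π g = b.1 := hg
  exact ⟨⟨g, by rw [hg]; exact b.2⟩, Subtype.ext hg⟩

/-- The image of an open set of `G` is open in `G'_π`. -/
theorem eventually_mem_image (b : π.Base) {c : G} (hc : π c = b.1) {U : Set G} (hU : U ∈ 𝓝 c) :
    ∀ᶠ b' : π.Base in 𝓝 b, b'.1 ∈ π '' U := by
  obtain ⟨ε, hε, hεU⟩ := Metric.mem_nhds_iff.1 hU
  filter_upwards [Metric.ball_mem_nhds b hε] with b' hb'
  have hd : Metric.hausdorffDist (π ⁻¹' {b.1}) (π ⁻¹' {b'.1}) < ε := by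
    rw [Metric.mem_ball, dist_comm] at hb'; exact hb'
  obtain ⟨y, hy, hyc⟩ := Metric.exists_dist_lt_of_hausdorffDist_lt (x := c) hc hd
    (π.hausdorffEDist_ne_top _ _)
  exact ⟨y, hεU (by rwa [Metric.mem_ball, dist_comm]), hy⟩

/-- One point `c` of the fibre is enough: fibres close to that of `b` have a point near `c`, where
`π` is continuous. -/
theorem continuous_base_val : Continuous fun b : π.Base => b.1 := by
  refine continuous_iff_continuousAt.2 fun b => Filter.tendsto_def.2 fun V hV => ?_
  obtain ⟨c, hc⟩ := π.surjective b.1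
  have hc : π c = b.1 := hc
  have hU : π ⁻¹' V ∈ 𝓝 c := π.isProperMap.continuous.continuousAt (by rw [hc]; exact hV)
  filter_upwards [π.eventually_mem_image b hc hU] with b' hb'
  obtain ⟨y, hy, hyb⟩ := hb'
  rw [mem_preimage, ← hyb]
  exact hy

/-- The topology of `G'_π` is generated by that of `G'` and the images of the open sets of `G`. -/
theorem tendsto_base {Z : Type*} {l : Filter Z} {f : Z → π.Base} {b : π.Base}
    (h : Filter.Tendsto (fun z => (f z).1) l (𝓝 b.1))
    (hU : ∀ c, π c = b.1 → ∀ U ∈ 𝓝 c, ∀ᶠ z in l, (f z).1 ∈ π '' U) :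
    Filter.Tendsto f l (𝓝 b) := by
  rw [Metric.tendsto_nhds]
  intro ε hε
  obtain ⟨t, ht, htc⟩ := (π.isCompact_fibre b.1).elim_nhds_subcover (fun c => Metric.ball c (ε / 4))
    fun c _ => Metric.ball_mem_nhds c (by positivity)
  -- One half of the Hausdorff estimate: the fibre over `f z` comes near every centre `c`. Passing
  -- from a point to its centre and on to the nearby fibre costs `ε / 4` twice.
  have h1 : ∀ᶠ z in l, ∀ c ∈ t, (f z).1 ∈ π '' Metric.ball c (ε / 4) := by
    rw [Filter.eventually_all_finset]
    exact fun c hc => hU c (ht c hc) _ (Metric.ball_mem_nhds c (by positivity))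
  -- The other half needs only that `π` is closed: fibres over points near `b` stay in the open
  -- cover of the fibre over `b`.
  have h2 : ∀ᶠ y' in 𝓝 b.1, ∀ x ∈ π ⁻¹' {y'}, x ∈ ⋃ c ∈ t, Metric.ball c (ε / 4) := by
    refine π.isProperMap.isClosedMap.eventually_nhds_fiber b.1 fun x hx => ?_
    exact (isOpen_biUnion fun c _ => Metric.isOpen_ball).mem_nhds (htc hx)
  filter_upwards [h1, h.eventually h2] with z hz1 hz2
  have : Metric.hausdorffDist (π ⁻¹' {(f z).1}) (π ⁻¹' {b.1}) ≤ ε / 2 := by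
    refine Metric.hausdorffDist_le_of_mem_dist (by positivity) (fun x hx => ?_) fun x hx => ?_
    · obtain ⟨c, hct, hxc⟩ := mem_iUnion₂.1 (hz2 x hx)
      exact ⟨c, ht c hct, by rw [Metric.mem_ball] at hxc; linarith⟩
    · obtain ⟨c, hct, hxc⟩ := mem_iUnion₂.1 (htc hx)
      obtain ⟨y, hy, hyf⟩ := hz1 c hct
      refine ⟨y, hyf, ?_⟩
      rw [Metric.mem_ball] at hxc hy
      linarith [dist_triangle_right x y c]
  exact this.trans_lt (by linarith)

theorem continuous_total_val : Continuous fun g : π.Total => g.1 := by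
  refine continuous_iff_continuousAt.2 fun g => tendsto_iff_dist_tendsto_zero.2 ?_
  refine squeeze_zero (fun _ => dist_nonneg) (fun h => ?_)
    (tendsto_iff_dist_tendsto_zero.1 (Filter.tendsto_id (x := 𝓝 g)))
  exact le_add_of_nonneg_right (dist_nonneg (x := π.proj h) (y := π.proj g))

theorem continuous_proj : Continuous π.proj := by
  refine continuous_iff_continuousAt.2 fun g => tendsto_iff_dist_tendsto_zero.2 ?_
  refine squeeze_zero (fun _ => dist_nonneg) (fun h => ?_)
    (tendsto_iff_dist_tendsto_zero.1 (Filter.tendsto_id (x := 𝓝 g)))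
  exact le_add_of_nonneg_left (dist_nonneg (x := h.1) (y := g.1))

theorem tendsto_total {Z : Type*} {l : Filter Z} {f : Z → π.Total} {g : π.Total}
    (h : Filter.Tendsto (fun z => (f z).1) l (𝓝 g.1))
    (h' : Filter.Tendsto (fun z => π.proj (f z)) l (𝓝 (π.proj g))) :
    Filter.Tendsto f l (𝓝 g) := by
  rw [tendsto_iff_dist_tendsto_zero] at h h' ⊢
  have := h.add h'
  rw [add_zero] at this
  exact this

/-- The sum metric gives `G_π` the topology of the fibre product of `G` and `G'_π` over `G'`, and
that fibre product is closed because `G'` is Hausdorff. -/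
theorem isClosedEmbedding_total [T2Space G'] :
    IsClosedEmbedding fun g : π.Total => (g.1, π.proj g) := by
  have hc := π.continuous_total_val.prodMk π.continuous_proj
  refine ⟨⟨isInducing_iff_nhds.2 fun g => le_antisymm ?_ ?_, fun a b hab => ?_⟩, ?_⟩
  · exact (hc.tendsto g).le_comap
  · refine π.tendsto_total (l := Filter.comap _ _) (f := id) ?_ ?_
    · exact (continuous_fst.tendsto _).comp Filter.tendsto_comap
    · exact (continuous_snd.tendsto _).comp Filter.tendsto_comap
  · exact Subtype.ext (congrArg Prod.fst hab)
  · have : range (fun g : π.Total => (g.1, π.proj g)) = {p : G × π.Base | π p.1 = p.2.1} := by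
      ext ⟨g, b⟩
      constructor
      · rintro ⟨t, ht⟩
        obtain ⟨rfl, rfl⟩ := Prod.mk.inj ht
        rfl
      · intro h
        have h : π g = b.1 := h
        exact ⟨⟨g, by rw [h]; exact b.2⟩, Prod.ext rfl (Subtype.ext h)⟩
    rw [this]
    exact isClosed_eq (π.isProperMap.continuous.comp continuous_fst)
      (π.continuous_base_val.comp continuous_snd)

/-- This is the base change of `π`: the product of `π` with the identity is proper, and it stays so
on the closed subspace `G_π`. -/
theorem isProperMap_proj [T2Space G'] : IsProperMap π.proj := by
  have h1 : IsProperMap (Prod.map π (id : π.Base → π.Base)) := π.isProperMap.prodMap isProperMap_id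
  have h2 := h1.comp π.isClosedEmbedding_total.isProperMap
  exact isProperMap_of_comp_of_inj (g := fun b : π.Base => (b.1, b)) π.continuous_proj
    (π.continuous_base_val.prodMk continuous_id) h2 fun a b hab => congrArg Prod.snd hab

/-! ### Double points of a regular map -/

/-- The pairs of distinct points of `G` with the same image in `G'`. -/
def OffDiag : Set (G × G) := {p | π p.1 = π p.2 ∧ p.1 ≠ p.2}

/-- The common image in `G'_π` of a pair of distinct points of `G` in one fibre. -/
def offDiagMap (p : π.OffDiag) : π.Base := ⟨π p.1.1, p.1.1, rfl, p.1.2, p.2.1.symm, p.2.2⟩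

theorem offDiagMap_surjective : Function.Surjective π.offDiagMap := by
  rintro ⟨g', x, hx, y, hy, hxy⟩
  have hx : π x = g' := hx
  have hy : π y = g' := hy
  exact ⟨⟨(x, y), hx.trans hy.symm, hxy⟩, Subtype.ext hx⟩

variable {π} in
-- Two distinct points stay apart under small perturbation, so nearby fibres have diameter bounded
-- below and regularity leaves only the alternative that they are close in Hausdorff distance.
theorem continuous_offDiagMap (hπ : IsRegularMap π) : Continuous π.offDiagMap := by
  refine continuous_iff_continuousAt.2 fun p => π.tendsto_base ?_ fun c hc U hU => ?_
  · exact (π.isProperMap.continuous.comp (continuous_fst.comp continuous_subtype_val)).tendsto p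
  · have hc : π c = π p.1.1 := hc
    obtain ⟨δ, hδ, hδU⟩ := Metric.mem_nhds_iff.1 hU
    have hab : 0 < dist p.1.1 p.1.2 := dist_pos.2 p.2.2
    -- The bound `δ` produces a point of the nearby fibre in `U`; half the distance of the pair
    -- excludes small diameters.
    obtain ⟨V, hV, hpV, hVd⟩ := hπ (π p.1.1) (min δ (dist p.1.1 p.1.2 / 2)) (by positivity)
    have h1 : ∀ᶠ q : π.OffDiag in 𝓝 p, π q.1.1 ∈ V :=
      (π.isProperMap.continuous.comp (continuous_fst.comp continuous_subtype_val)).continuousAt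
        (hV.mem_nhds hpV)
    have h2 : ∀ᶠ q : π.OffDiag in 𝓝 p, dist p.1.1 p.1.2 / 2 < dist q.1.1 q.1.2 :=
      (by fun_prop : Continuous fun q : π.OffDiag => dist q.1.1 q.1.2).continuousAt.eventually
        (lt_mem_nhds (by simpa using hab))
    filter_upwards [h1, h2] with q hq1 hq2
    obtain h | h := hVd _ hq1
    · obtain ⟨y, hy, hyc⟩ := Metric.exists_dist_lt_of_hausdorffDist_lt (x := c) hc
        (h.trans_le (min_le_left _ _)) (π.hausdorffEDist_ne_top _ _)
      exact ⟨y, hδU (by rwa [Metric.mem_ball, dist_comm]), hy⟩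
    · have h3 : dist q.1.1 q.1.2 ≤ Metric.diam (π ⁻¹' {π q.1.1}) :=
        Metric.dist_le_diam_of_mem (π.isCompact_fibre _).isBounded rfl q.2.1.symm
      linarith [min_le_right δ (dist p.1.1 p.1.2 / 2)]

end Metric

end FactorMap


/-! ### `G_π` and `G'_π` are étale groupoids -/

theorem IsEtale.exists_section {H : Type u} [TopologicalSpace H] [GroupoidStr H] [IsEtale H]
    (g : H) : ∃ σ : Units H → H, ContinuousAt σ ⟨rng g, rng_rng g⟩ ∧ σ ⟨rng g, rng_rng g⟩ = g ∧
      ∀ x, rng (σ x) = x.1 := by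
  classical
  obtain ⟨e, hg, he⟩ := IsEtale.isLocalHomeomorph_rng (G := H) g
  have hr (h : H) : (e h).1 = rng h := by rw [← he]
  have hgt : (⟨rng g, rng_rng g⟩ : Units H) ∈ e.target := by
    have : e g = ⟨rng g, rng_rng g⟩ := Subtype.ext (hr g)
    exact this ▸ e.map_source hg
  -- Outside the domain of the local inverse the value is the unit itself, so the section is defined
  -- everywhere while being continuous only at the chosen point.
  refine ⟨fun x => if x ∈ e.target then e.symm x else x.1, ?_, ?_, fun x => ?_⟩
  · refine (e.continuousAt_symm hgt).congr ?_
    filter_upwards [e.open_target.mem_nhds hgt] with x hx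
    rw [if_pos hx]
  · have : e g = ⟨rng g, rng_rng g⟩ := Subtype.ext (hr g)
    exact (if_pos hgt).trans ((congrArg e.symm this.symm).trans (e.left_inv hg))
  · by_cases hx : x ∈ e.target
    · simp only [hx, if_true]
      rw [← hr, e.right_inv hx]
    · simp only [hx, if_false]
      exact x.2

/-- A range map with local sections is a local homeomorphism if it is locally injective. -/
theorem isLocalHomeomorph_rng_of_sections {H : Type u} [TopologicalSpace H] [GroupoidStr H]
    (hc : Continuous (rng : H → H)) (hi : ∀ g : H, ∃ U ∈ 𝓝 g, InjOn rng U)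
    (hs : ∀ g : H, ∃ σ : Units H → H, ContinuousAt σ ⟨rng g, rng_rng g⟩ ∧
      σ ⟨rng g, rng_rng g⟩ = g ∧ ∀ x, rng (σ x) = x.1) :
    IsLocalHomeomorph fun g : H => (⟨rng g, rng_rng g⟩ : Units H) := by
  have ho : IsOpenMap fun g : H => (⟨rng g, rng_rng g⟩ : Units H) := by
    refine IsOpenMap.of_sections fun g => ?_
    obtain ⟨σ, h1, h2, h3⟩ := hs g
    exact ⟨σ, h1, h2, fun x => Subtype.ext (h3 x)⟩
  refine isLocalHomeomorph_iff_isOpenEmbedding_restrict.2 fun g => ?_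
  obtain ⟨U, hU, hinj⟩ := hi g
  obtain ⟨V, hVU, hV, hgV⟩ := mem_nhds_iff.1 hU
  refine ⟨V, hV.mem_nhds hgV, .of_continuous_injective_isOpenMap ?_ ?_ ?_⟩
  · exact (hc.subtype_mk _).comp continuous_subtype_val
  · intro a b hab
    exact Subtype.ext (hinj (hVU a.2) (hVU b.2) (congrArg Subtype.val hab))
  · exact ho.domRestrict hV

theorem IsEtale.exists_injOn_rng {H : Type u} [TopologicalSpace H] [GroupoidStr H] [IsEtale H]
    (g : H) : ∃ U ∈ 𝓝 g, InjOn rng U := by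
  obtain ⟨U, hU, hg, hi⟩ := (IsEtale.isLocalHomeomorph_rng (G := H)).isLocallyInjective g
  exact ⟨U, hU.mem_nhds hg, fun a ha b hb hab => hi ha hb (Subtype.ext hab)⟩

namespace FactorMap

variable {G G' : Type u} [GroupoidStr G] [GroupoidStr G'] [MetricSpace G] [TopologicalSpace G']
  [IsEtale G] [IsEtale G'] (π : FactorMap G G')

theorem continuous_rng_base : Continuous (rng : π.Base → π.Base) := by
  refine continuous_iff_continuousAt.2 fun b => π.tendsto_base ?_ fun c hc U hU => ?_
  · exact (IsEtale.continuous_rng.comp π.continuous_base_val).tendsto b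
  · have hc : π c = rng b.1 := hc
    -- The unit `c` is the range of an arrow `g` over `b`. Nearby fibres have points near `g`, and
    -- the ranges of these points lie in `U`.
    obtain ⟨g, rfl, hg⟩ := π.exists_lift (π.rng_unit_of_map hc) b.1 hc.symm
    filter_upwards [π.eventually_mem_image b hg (IsEtale.continuous_rng.continuousAt hU)]
    rintro b' ⟨y, hy, hyb⟩
    exact ⟨rng y, hy, by rw [π.map_rng, hyb]; rfl⟩

theorem continuous_inv_base : Continuous (inv : π.Base → π.Base) := by
  refine continuous_iff_continuousAt.2 fun b => π.tendsto_base ?_ fun c hc U hU => ?_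
  · exact (IsEtale.continuous_inv.comp π.continuous_base_val).tendsto b
  · have hc : π c = inv b.1 := hc
    have hg : π (inv c) = b.1 := by rw [π.map_inv, hc, GroupoidStr.inv_inv]
    have hU' : inv ⁻¹' U ∈ 𝓝 (inv c) :=
      IsEtale.continuous_inv.continuousAt (by rwa [GroupoidStr.inv_inv])
    filter_upwards [π.eventually_mem_image b hg hU']
    rintro b' ⟨y, hy, hyb⟩
    exact ⟨inv y, hy, by rw [π.map_inv, hyb]; rfl⟩

/-- The topology of `G'_π` is induced by the inclusion in `G'` and the range map. -/
theorem tendsto_base_of_rng {Z : Type*} {l : Filter Z} {f : Z → π.Base} {b : π.Base}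
    (h : Filter.Tendsto (fun z => (f z).1) l (𝓝 b.1))
    (hr : Filter.Tendsto (fun z => rng (f z)) l (𝓝 (rng b))) : Filter.Tendsto f l (𝓝 b) := by
  refine π.tendsto_base h fun c hc U hU => ?_
  have hc : π c = b.1 := hc
  rw [π.isInducing_map_rng.nhds_eq_comap, Filter.mem_comap] at hU
  obtain ⟨T, hT, hTU⟩ := hU
  obtain ⟨V, hV, W, hW, hVW⟩ := mem_nhds_prod_iff.1 hT
  rw [hc] at hV
  filter_upwards [h.eventually hV, hr.eventually (π.eventually_mem_image (rng b)
    (by rw [π.map_rng, hc]; rfl) hW)]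
  rintro z hz ⟨x, hxW, hx⟩
  have hx : π x = rng (f z).1 := hx
  -- A unit in `W` over the range of `f z` is the range of an arrow `k` over `f z`. Both coordinates
  -- of `k` then lie in the chosen neighbourhoods.
  obtain ⟨k, rfl, hk⟩ := π.exists_lift (π.rng_unit_of_map hx) (f z).1 hx.symm
  exact ⟨k, hTU (hVW ⟨(by rw [hk]; exact hz : π k ∈ V), hxW⟩), hk⟩

theorem continuous_mul_base :
    Continuous fun p : {p : π.Base × π.Base // src p.1 = rng p.2} => mul p.1.1 p.1.2 p.2 := by
  refine continuous_iff_continuousAt.2 fun p => π.tendsto_base_of_rng ?_ ?_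
  · refine Continuous.tendsto (f := fun p : {p : π.Base × π.Base // src p.1 = rng p.2} =>
      mul p.1.1.1 p.1.2.1 (congrArg Subtype.val p.2)) ?_ p
    exact IsEtale.continuous_mul_comp
      (π.continuous_base_val.comp (continuous_fst.comp continuous_subtype_val))
      (π.continuous_base_val.comp (continuous_snd.comp continuous_subtype_val)) _
  · simp only [rng_mul]
    exact (π.continuous_rng_base.comp (continuous_fst.comp continuous_subtype_val)).tendsto p

theorem exists_section_base (b : π.Base) : ∃ σ : Units π.Base → π.Base,
    ContinuousAt σ ⟨rng b, rng_rng b⟩ ∧ σ ⟨rng b, rng_rng b⟩ = b ∧ ∀ x, rng (σ x) = x.1 := by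
  obtain ⟨σ, h1, h2, h3⟩ := IsEtale.exists_section b.1
  let j : Units π.Base → Units G' := fun x => ⟨x.1.1, congrArg Subtype.val x.2⟩
  have hj : Continuous j := (π.continuous_base_val.comp continuous_subtype_val).subtype_mk _
  -- Whether an arrow belongs to `G'_π` depends only on its range, so the section of `G'` takes
  -- values in `G'_π`.
  let τ : Units π.Base → π.Base := fun x =>
    ⟨σ (j x), by rw [← π.nontrivial_rng, h3]; exact x.1.2⟩
  have hτ (x) : rng (τ x) = x.1 := Subtype.ext (h3 _)
  have hτb : τ ⟨rng b, rng_rng b⟩ = b := Subtype.ext h2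
  refine ⟨τ, ?_, hτb, hτ⟩
  refine π.tendsto_base_of_rng ?_ ?_
  · exact h1.comp (f := j) (x := (⟨rng b, rng_rng b⟩ : Units π.Base)) hj.continuousAt
  · simp only [hτ]
    exact continuous_subtype_val.tendsto _

variable {π} in
theorem isEtale_base (hπ : IsRegularMap π) : IsEtale π.Base where
  toT2Space := inferInstance
  toLocallyCompactSpace := by
    have : WeaklyLocallyCompactSpace π.Base := ⟨fun b => by
      -- Take disjoint compact neighbourhoods `K`, `L` of two points of the fibre. The pairs in `K ×
      -- L` lying in one fibre form a compact set. Its image is a neighbourhood of `b`, since all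
      -- nearby fibres meet both `K` and `L`.
      obtain ⟨⟨⟨x, y⟩, hp, hxy⟩, rfl⟩ := π.offDiagMap_surjective b
      obtain ⟨U, V, hU, hV, hUV⟩ := t2_separation_nhds hxy
      obtain ⟨K, hK, hKU, hKc⟩ := LocallyCompactSpace.local_compact_nhds x U hU
      obtain ⟨L, hL, hLV, hLc⟩ := LocallyCompactSpace.local_compact_nhds y V hV
      have hne {a c : G} (ha : a ∈ K) (hc : c ∈ L) : a ≠ c := fun h =>
        disjoint_left.1 hUV (hKU ha) (h ▸ hLV hc)
      let S : Set (G × G) := (K ×ˢ L) ∩ {p | π p.1 = π p.2}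
      have hS : IsCompact S := (hKc.prod hLc).inter_right
        (isClosed_eq (π.isProperMap.continuous.comp continuous_fst)
          (π.isProperMap.continuous.comp continuous_snd))
      have := isCompact_iff_compactSpace.1 hS
      let q : S → π.Base := fun p => π.offDiagMap ⟨p.1, p.2.2, hne p.2.1.1 p.2.1.2⟩
      have hq : Continuous q :=
        (continuous_offDiagMap hπ).comp (continuous_subtype_val.subtype_mk _)
      refine ⟨range q, isCompact_range hq, ?_⟩
      filter_upwards [π.eventually_mem_image (π.offDiagMap ⟨(x, y), hp, hxy⟩) (c := x) rfl hK,
        π.eventually_mem_image (π.offDiagMap ⟨(x, y), hp, hxy⟩) (c := y) hp.symm hL]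
      rintro b ⟨a, ha, hab⟩ ⟨c, hc, hcb⟩
      exact ⟨⟨(a, c), ⟨ha, hc⟩, hab.trans hcb.symm⟩, Subtype.ext hab⟩⟩
    infer_instance
  toSecondCountableTopology := by
    -- A metric space that is a continuous image of a subspace of the second countable space `G × G`
    -- is separable, hence second countable.
    have := (π.offDiagMap_surjective.denseRange).separableSpace (continuous_offDiagMap hπ)
    exact UniformSpace.secondCountable_of_separable _
  continuous_inv := π.continuous_inv_base
  continuous_mul := π.continuous_mul_base
  isLocalHomeomorph_rng := by
    refine isLocalHomeomorph_rng_of_sections π.continuous_rng_base (fun b => ?_)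
      π.exists_section_base
    obtain ⟨U, hU, hi⟩ := IsEtale.exists_injOn_rng b.1
    exact ⟨_, π.continuous_base_val.continuousAt hU, fun a ha c hc hac =>
      Subtype.ext (hi ha hc (congrArg Subtype.val hac))⟩

theorem continuous_rng_total : Continuous (rng : π.Total → π.Total) := by
  refine continuous_iff_continuousAt.2 fun g => π.tendsto_total ?_ ?_
  · exact (IsEtale.continuous_rng.comp π.continuous_total_val).tendsto g
  · have h (g : π.Total) : π.proj (rng g) = rng (π.proj g) := Subtype.ext (π.map_rng g.1)
    simp only [h]
    exact (π.continuous_rng_base.comp π.continuous_proj).tendsto g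

theorem isEtale_total [IsEtale π.Base] : IsEtale π.Total where
  toT2Space := inferInstance
  toLocallyCompactSpace := π.isClosedEmbedding_total.locallyCompactSpace
  toSecondCountableTopology := π.isClosedEmbedding_total.isEmbedding.secondCountableTopology
  continuous_inv := by
    refine continuous_iff_continuousAt.2 fun g => π.tendsto_total ?_ ?_
    · exact (IsEtale.continuous_inv.comp π.continuous_total_val).tendsto g
    · have h (g : π.Total) : π.proj (inv g) = inv (π.proj g) := Subtype.ext (π.map_inv g.1)
      simp only [h]
      exact (π.continuous_inv_base.comp π.continuous_proj).tendsto g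
  continuous_mul := by
    have h1 : Continuous fun p : {p : π.Total × π.Total // src p.1 = rng p.2} => p.1.1 :=
      continuous_fst.comp continuous_subtype_val
    have h2 : Continuous fun p : {p : π.Total × π.Total // src p.1 = rng p.2} => p.1.2 :=
      continuous_snd.comp continuous_subtype_val
    refine continuous_iff_continuousAt.2 fun p => π.tendsto_total ?_ ?_
    · refine Continuous.tendsto (f := fun p : {p : π.Total × π.Total // src p.1 = rng p.2} =>
        mul p.1.1.1 p.1.2.1 (congrArg Subtype.val p.2)) ?_ p
      exact IsEtale.continuous_mul_comp (π.continuous_total_val.comp h1)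
        (π.continuous_total_val.comp h2) _
    · have he (p : {p : π.Total × π.Total // src p.1 = rng p.2}) :
          src (π.proj p.1.1) = rng (π.proj p.1.2) := Subtype.ext <| by
        change src (π p.1.1.1) = rng (π p.1.2.1)
        rw [← π.map_src, ← π.map_rng]
        exact congrArg π.toFun (congrArg Subtype.val p.2)
      have h (p : {p : π.Total × π.Total // src p.1 = rng p.2}) :
          π.proj (mul p.1.1 p.1.2 p.2) = mul (π.proj p.1.1) (π.proj p.1.2) (he p) :=
        Subtype.ext (π.map_mul _ _ _)
      simp only [h]
      exact (IsEtale.continuous_mul_comp (π.continuous_proj.comp h1) (π.continuous_proj.comp h2)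
        he).tendsto p
  isLocalHomeomorph_rng := by
    refine isLocalHomeomorph_rng_of_sections π.continuous_rng_total (fun b => ?_) fun g => ?_
    · obtain ⟨U, hU, hi⟩ := IsEtale.exists_injOn_rng b.1
      exact ⟨_, π.continuous_total_val.continuousAt hU, fun a ha c hc hac =>
        Subtype.ext (hi ha hc (congrArg Subtype.val hac))⟩
    · obtain ⟨σ, h1, h2, h3⟩ := IsEtale.exists_section (π.proj g)
      let j : Units π.Total → Units π.Base := fun x => ⟨π.proj x.1, Subtype.ext <| by
        change rng (π x.1.1) = π x.1.1
        rw [← π.map_rng]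
        exact congrArg π.toFun (congrArg Subtype.val x.2)⟩
      have hj : Continuous j := (π.continuous_proj.comp continuous_subtype_val).subtype_mk _
      have hjg : j ⟨rng g, rng_rng g⟩ = ⟨rng (π.proj g), rng_rng _⟩ :=
        Subtype.ext (Subtype.ext (π.map_rng g.1))
      -- The section of `G'_π` lifts uniquely to arrows of `G` with prescribed range. The lift is
      -- continuous at the point because its image and its range are.
      choose τ hτ1 hτ2 using fun x : Units π.Total => π.exists_lift (x := x.1.1)
        (congrArg Subtype.val x.2) (σ (j x)).1 (congrArg Subtype.val (h3 (j x)))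
      let t : Units π.Total → π.Total := fun x => ⟨τ x, by rw [hτ2]; exact (σ (j x)).2⟩
      have ht (x) : rng (t x) = x.1 := Subtype.ext (hτ1 x)
      have htp (x) : π.proj (t x) = σ (j x) := Subtype.ext (hτ2 x)
      have htg : t ⟨rng g, rng_rng g⟩ = g := by
        refine Subtype.ext (π.injOn_fibre (hτ1 _) ?_)
        exact congrArg Subtype.val ((htp _).trans (by rw [hjg, h2]))
      have hlim : Filter.Tendsto (fun x => π.proj (t x)) (𝓝 ⟨rng g, rng_rng g⟩)
          (𝓝 (π.proj (t ⟨rng g, rng_rng g⟩))) := by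
        simp only [htp]
        refine ContinuousAt.comp (g := σ) ?_ hj.continuousAt
        rw [hjg]
        exact h1
      refine ⟨t, ?_, htg, ht⟩
      refine π.tendsto_total (π.tendsto_of_map_rng ?_ ?_) hlim
      · exact (π.continuous_base_val.tendsto _).comp hlim
      · have h (x) : rng (t x).1 = x.1.1 := hτ1 x
        simp only [h]
        exact (π.continuous_total_val.comp continuous_subtype_val).tendsto _

/-- The factor map `G_π → G'_π`. -/
def reduced : FactorMap π.Total π.Base where
  toFun := π.proj
  map_rng g := Subtype.ext (π.map_rng g.1)
  map_src g := Subtype.ext (π.map_src g.1)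
  map_mul g h e := Subtype.ext (π.map_mul g.1 h.1 (congrArg Subtype.val e))
  isProperMap := π.isProperMap_proj
  surjective := π.proj_surjective
  bijOn_fibre x hx := by
    refine ⟨fun g hg => ?_, fun g hg h hh hgh => ?_, fun b hb => ?_⟩
    · have hg : rng g = x := hg
      exact (Subtype.ext (π.map_rng g.1).symm : rng (π.proj g) = π.proj (rng g)).trans (by rw [hg])
    · have hg : rng g = x := hg
      have hh : rng h = x := hh
      exact Subtype.ext (π.injOn_fibre (congrArg Subtype.val (hg.trans hh.symm))
        (congrArg Subtype.val hgh))
    · obtain ⟨g, hg, hgb⟩ := π.exists_lift (congrArg Subtype.val hx : rng x.1 = x.1) b.1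
        (congrArg Subtype.val hb)
      exact ⟨⟨g, by rw [hgb]; exact b.2⟩, Subtype.ext hg, Subtype.ext hgb⟩

end FactorMap


/-! ### Functions on totally disconnected spaces -/

section Functions

variable {X Y Z : Type*} [TopologicalSpace X] [TopologicalSpace Y] [TopologicalSpace Z]
  {A : Type v} [AddCommGroup A] [TopologicalSpace A]

theorem IsCompact.exists_isCompact_isOpen_between [T2Space X] [LocallyCompactSpace X]
    [TotallyDisconnectedSpace X] {K U : Set X} (hK : IsCompact K) (hU : IsOpen U) (hKU : K ⊆ U) :
    ∃ V, IsCompact V ∧ IsOpen V ∧ K ⊆ V ∧ V ⊆ U := by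
  obtain ⟨M, hM, hKM, hMU⟩ := exists_compact_between hK hU hKU
  choose! W hW using fun x (hx : x ∈ K) =>
    loc_compact_Haus_tot_disc_of_zero_dim.exists_subset_of_mem_open (hKM hx) isOpen_interior
  obtain ⟨t, ht, hKt⟩ := hK.elim_nhds_subcover W fun x hx =>
    (hW x hx).1.isOpen.mem_nhds (hW x hx).2.1
  have hc : IsClopen (⋃ x ∈ t, W x) := t.finite_toSet.isClopen_biUnion fun x hx => (hW x (ht x hx)).1
  have hs : ⋃ x ∈ t, W x ⊆ M := iUnion₂_subset fun x hx =>
    (hW x (ht x hx)).2.2.trans interior_subset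
  exact ⟨_, hM.of_isClosed_subset hc.isClosed hs, hc.isOpen, hKt, hs.trans hMU⟩

/-- The function that agrees with `f` on the compact open set `V` and vanishes elsewhere. -/
noncomputable def cutoff [T2Space X] (f : X → A) (hf : Continuous f) (V : Set X)
    (hV : IsCompact V) (hV' : IsOpen V) : C_c(X, A) where
  toFun := V.indicator f
  continuous_toFun := hf.indicator fun x hx => by
    rw [IsClopen.frontier_eq ⟨hV.isClosed, hV'⟩] at hx
    exact hx.elim
  hasCompactSupport' := HasCompactSupport.intro hV fun _ hx => indicator_of_notMem hx f

theorem cutoff_of_mem [T2Space X] {f : X → A} {hf : Continuous f} {V : Set X}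
    {hV : IsCompact V} {hV' : IsOpen V} {x : X} (hx : x ∈ V) : cutoff f hf V hV hV' x = f x :=
  indicator_of_mem hx f

theorem cutoff_of_notMem [T2Space X] {f : X → A} {hf : Continuous f} {V : Set X}
    {hV : IsCompact V} {hV' : IsOpen V} {x : X} (hx : x ∉ V) : cutoff f hf V hV hV' x = 0 :=
  indicator_of_notMem hx f

variable [DiscreteTopology A]

/-- The functions pulled back along a proper surjection are those that are constant on fibres. -/
theorem exists_pullback_eq_iff [T2Space X] [T2Space Y] {q : X → Y} (hq : IsProperMap q)
    (hs : Function.Surjective q) (f : C_c(X, A)) :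
    (∃ g, pullback A q hq g = f) ↔ Function.FactorsThrough f q := by
  constructor
  · rintro ⟨g, rfl⟩ x y hxy
    exact congrArg g hxy
  · intro h
    have hfac (x : X) : f (Function.surjInv hs (q x)) = f x := h (Function.surjInv_eq hs _)
    refine ⟨⟨⟨fun y => f (Function.surjInv hs y), ?_⟩, ?_⟩, ?_⟩
    · rw [(hq.isClosedMap.isQuotientMap hq.continuous hs).continuous_iff]
      exact f.continuous.congr fun x => (hfac x).symm
    · refine HasCompactSupport.intro (f.hasCompactSupport.isCompact.image hq.continuous) ?_
      intro y hy
      exact image_eq_zero_of_notMem_tsupport (f := f)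
        fun hy' => hy ⟨_, hy', Function.surjInv_eq hs y⟩
    · ext x
      exact hfac x

/-- A locally constant function on a compact subspace extends to the whole space. -/
theorem exists_extension [T2Space X] [LocallyCompactSpace X] [TotallyDisconnectedSpace X]
    {j : Z → X} (hj : Continuous j) (hinj : Function.Injective j) {g : Z → A} (hg : Continuous g)
    {K : Set Z} (hK : IsCompact K) : ∃ F : C_c(X, A), ∀ z ∈ K, F (j z) = g z := by
  classical
  have hfin : (g '' K).Finite := (hK.image hg).finite_of_discrete
  -- The level sets of `g` in `K` have disjoint compact images. The sets `V a` may overlap, but a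
  -- point of `j '' K` lies only in the one for its own value.
  have hV (a : A) : ∃ V, IsCompact V ∧ IsOpen V ∧ j '' (K ∩ g ⁻¹' {a}) ⊆ V ∧
      V ⊆ (j '' (K ∩ g ⁻¹' {a}ᶜ))ᶜ := by
    refine IsCompact.exists_isCompact_isOpen_between ?_ ?_ ?_
    · exact (hK.inter_right ((isClosed_discrete _).preimage hg)).image hj
    · exact ((hK.inter_right ((isClosed_discrete _).preimage hg)).image hj).isClosed.isOpen_compl
    · rintro _ ⟨z, ⟨-, hz⟩, rfl⟩ ⟨w, ⟨-, hw⟩, hwz⟩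
      rw [hinj hwz] at hw
      exact hw hz
  choose V hVc hVo hV1 hV2 using hV
  refine ⟨∑ a ∈ hfin.toFinset, cutoff (fun _ => a) continuous_const (V a) (hVc a) (hVo a), ?_⟩
  intro z hz
  rw [CompactlySupportedContinuousMap.sum_apply, Finset.sum_eq_single (g z)]
  · exact cutoff_of_mem (hV1 _ ⟨z, ⟨hz, rfl⟩, rfl⟩)
  · intro a _ ha
    exact cutoff_of_notMem fun h => hV2 a h ⟨z, ⟨hz, fun h => ha h.symm⟩, rfl⟩
  · intro h
    exact (h (hfin.mem_toFinset.2 ⟨z, hz, rfl⟩)).elim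

end Functions

theorem fibreSum_eq_of_existsUnique {X Y X' Y' A : Type*} [AddCommMonoid A] {p : X → Y}
    {p' : X' → Y'} {q : X → X'} {y : Y} {y' : Y'} (h : ∀ x, p x = y → p' (q x) = y')
    (hu : ∀ x', p' x' = y' → ∃! x, p x = y ∧ q x = x') (f : X' → A) :
    fibreSum p' f y' = fibreSum p (fun x => f (q x)) y := by
  let e : p ⁻¹' {y} → p' ⁻¹' {y'} := fun x => ⟨q x.1, h x.1 x.2⟩
  refine (finsum_eq_of_bijective e ⟨fun a b hab => ?_, fun x' => ?_⟩ fun _ => rfl).symm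
  · exact Subtype.ext ((hu (q a.1) (h a.1 a.2)).unique ⟨a.2, rfl⟩
      ⟨b.2, (congrArg Subtype.val hab).symm⟩)
  · obtain ⟨x, ⟨hx, hqx⟩, -⟩ := hu x'.1 x'.2
    exact ⟨⟨x, hx⟩, Subtype.ext hqx⟩

instance Nerve.locallyCompactSpace {G : Type u} [TopologicalSpace G] [GroupoidStr G] [IsEtale G]
    {ι : Type} [Finite ι] : LocallyCompactSpace (Nerve G ι) :=
  (FactorMap.isClosed_nerve G ι).isClosedEmbedding_subtypeVal.locallyCompactSpace

/-! ### Nerves of `G_π` and `G'_π`, and fibres on which a function varies -/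

namespace FactorMap

variable {G G' : Type u} [GroupoidStr G] [GroupoidStr G'] {ι κ : Type}

theorem nerveMap_surjective [TopologicalSpace G] [TopologicalSpace G'] (π : FactorMap G G')
    [Nonempty ι] : Function.Surjective (π.nerveMap : Nerve G ι → Nerve G' ι) := by
  intro c'
  obtain ⟨l⟩ := ‹Nonempty ι›
  obtain ⟨x, hx⟩ := π.surjective (c'.1 l l)
  have hx : π x = rng (c'.1 l l) := by rw [c'.rng_diag]; exact hx
  have hu := π.rng_unit_of_map hx
  -- Lifting one vertex is enough: unique lifting along the inclusion of that vertex supplies all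
  -- the arrows.
  obtain ⟨c, ⟨-, hc⟩, -⟩ := π.nerve_lift (fun _ : Fin 1 => l) (Nerve.star (fun _ => x) fun _ _ => rfl)
    c' <| Nerve.ext_of_vertex 0 fun k => by
      change c'.1 l l = π ((Nerve.star (fun _ => x) fun _ _ => rfl : Nerve G (Fin 1)).1 0 k)
      rw [Nerve.star_unit _ _ 0 hu, hx, c'.rng_diag]
  exact ⟨c, hc⟩

/-- Two points of the nerve of `G` over the same point are equal if they share an arrow. -/
theorem nerve_eq_of_arrow_eq [TopologicalSpace G] [TopologicalSpace G'] (π : FactorMap G G')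
    {c d : Nerve G ι} (h : π.nerveMap c = π.nerveMap d) (i j : ι) (hij : c.1 i j = d.1 i j) :
    c = d :=
  Nerve.ext_of_vertex i fun k => π.injOn_fibre
    (by rw [c.rng_arrow, d.rng_arrow, ← c.rng_arrow i j, ← d.rng_arrow i j, hij])
    (congrFun (congrFun (congrArg Subtype.val h) i) k)

section Metric

variable [MetricSpace G] [TopologicalSpace G'] (π : FactorMap G G')

/-- The point of the nerve of `G_π` with given arrows. -/
def toNerveTotal (c : Nerve G ι) (h : ∀ i j, (π ⁻¹' {π (c.1 i j)}).Nontrivial) :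
    Nerve π.Total ι :=
  ⟨fun i j => ⟨c.1 i j, h i j⟩, fun i j k => by
    obtain ⟨e, h⟩ := c.2 i j k
    exact ⟨Subtype.ext e, Subtype.ext h⟩⟩

theorem nerveIncl_injective : Function.Injective (π.nerveIncl : Nerve π.Total ι → Nerve G ι) :=
  fun _ _ h => Subtype.ext <| funext fun i => funext fun j =>
    Subtype.ext (congrFun (congrFun (congrArg Subtype.val h) i) j)

/-- Points of the nerve over the same point that share an arrow coincide, so `c` and `d` differ in
every arrow. -/
theorem nontrivial_of_ne {c d : Nerve G ι} (h : π.nerveMap c = π.nerveMap d) (hne : c ≠ d)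
    (i j : ι) : (π ⁻¹' {π (c.1 i j)}).Nontrivial :=
  ⟨c.1 i j, rfl, d.1 i j, (congrFun (congrFun (congrArg Subtype.val h) i) j).symm,
    fun hij => hne (π.nerve_eq_of_arrow_eq h i j hij)⟩

/-- Having a nontrivial fibre passes between an arrow, its range and its inverse, hence from one
vertex to every arrow. -/
theorem nontrivial_of_vertex {c : Nerve G ι} (l : ι) (h : (π ⁻¹' {π (c.1 l l)}).Nontrivial)
    (i j : ι) : (π ⁻¹' {π (c.1 i j)}).Nontrivial := by
  have h1 : (π ⁻¹' {π (c.1 l i)}).Nontrivial := by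
    rw [← π.nontrivial_rng, ← π.map_rng, c.rng_arrow]
    exact h
  rw [← π.nontrivial_rng, ← π.map_rng, c.rng_arrow, c.diag l i, ← rng_inv, π.map_rng,
    π.nontrivial_rng, π.map_inv, π.nontrivial_inv]
  exact h1

/-- `G_π` contains every point of the nerve that has a vertex in it, so fibre sums along reindexing
maps are the same in `G_π` and in `G`. -/
theorem existsUnique_nerveIncl [Nonempty κ] (θ : κ → ι) (z : Nerve π.Total κ) (c : Nerve G ι)
    (h : Nerve.map θ c = π.nerveIncl z) : ∃! y, Nerve.map θ y = z ∧ π.nerveIncl y = c := by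
  obtain ⟨l⟩ := ‹Nonempty κ›
  have hl : c.1 (θ l) (θ l) = (z.1 l l).1 :=
    congrFun (congrFun (congrArg Subtype.val h) l) l
  refine ⟨π.toNerveTotal c (π.nontrivial_of_vertex (θ l) (by rw [hl]; exact (z.1 l l).2)),
    ⟨?_, rfl⟩, fun y hy => π.nerveIncl_injective hy.2⟩
  exact π.nerveIncl_injective h

/-- The inclusion `G'_π⁽ⁿ⁾ → G'⁽ⁿ⁾`. -/
def nerveInclBase (c : Nerve π.Base ι) : Nerve G' ι :=
  ⟨fun i j => (c.1 i j).1, fun i j k => by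
    obtain ⟨e, h⟩ := c.2 i j k
    exact ⟨congrArg Subtype.val e, congrArg Subtype.val h⟩⟩

theorem nerveInclBase_injective :
    Function.Injective (π.nerveInclBase : Nerve π.Base ι → Nerve G' ι) :=
  fun _ _ h => Subtype.ext <| funext fun i => funext fun j =>
    Subtype.ext (congrFun (congrFun (congrArg Subtype.val h) i) j)

theorem continuous_nerveInclBase :
    Continuous (π.nerveInclBase : Nerve π.Base ι → Nerve G' ι) :=
  (continuous_pi fun i => continuous_pi fun j =>
    π.continuous_base_val.comp (Nerve.continuous_arrow i j)).subtype_mk _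

theorem continuous_nerveIncl : Continuous (π.nerveIncl : Nerve π.Total ι → Nerve G ι) :=
  (continuous_pi fun i => continuous_pi fun j =>
    π.continuous_total_val.comp (Nerve.continuous_arrow i j)).subtype_mk _

theorem totallyDisconnectedSpace_base [TotallyDisconnectedSpace G'] :
    TotallyDisconnectedSpace π.Base :=
  ⟨isTotallyDisconnected_of_image π.continuous_base_val.continuousOn
    (fun _ _ h => Subtype.ext h) (isTotallyDisconnected_of_totallyDisconnectedSpace _)⟩

variable [IsEtale G']

theorem nerveMap_nerveIncl (c : Nerve π.Total ι) :
    π.nerveMap (π.nerveIncl c) = π.nerveInclBase (π.reduced.nerveMap c) := rfl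

variable [IsEtale G]

variable {A : Type v} [AddCommGroup A] [TopologicalSpace A] [DiscreteTopology A]

variable {π} in
/-- The fibres on which a compactly supported function is not constant lie over a compact subset
of `G'_π⁽ⁿ⁾`. -/
theorem exists_isCompact_nonconstant (hπ : IsRegularMap π) (f : C_c(Nerve G ι, A)) :
    ∃ D : Set (Nerve π.Base ι), IsCompact D ∧ ∀ c d : Nerve π.Total ι,
      π.reduced.nerveMap c = π.reduced.nerveMap d → f (π.nerveIncl c) ≠ f (π.nerveIncl d) →
        π.reduced.nerveMap c ∈ D := by
  have hp := π.isProperMap_nerveMap ι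
  let M : Set (Nerve G ι) := π.nerveMap ⁻¹' (π.nerveMap '' tsupport f)
  have hM : IsCompact M :=
    hp.isCompact_preimage (f.hasCompactSupport.isCompact.image hp.continuous)
  -- Since `A` is discrete, `f p.1 ≠ f p.2` is a closed condition. Hence `S` is compact, although it
  -- consists of off-diagonal pairs.
  let S : Set (Nerve G ι × Nerve G ι) :=
    (M ×ˢ M) ∩ ({p | π.nerveMap p.1 = π.nerveMap p.2} ∩ (fun p => (f p.1, f p.2)) ⁻¹' {a | a.1 ≠ a.2})
  have hS : IsCompact S := (hM.prod hM).inter_right <| (isClosed_eq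
    (hp.continuous.comp continuous_fst) (hp.continuous.comp continuous_snd)).inter <|
      (isClosed_discrete _).preimage
        ((f.continuous.comp continuous_fst).prodMk (f.continuous.comp continuous_snd))
  have := isCompact_iff_compactSpace.1 hS
  have hne (p : S) : p.1.1 ≠ p.1.2 := fun h => p.2.2.2 (congrArg f h)
  let q : S → Nerve π.Base ι := fun p =>
    π.reduced.nerveMap (π.toNerveTotal p.1.1 (π.nontrivial_of_ne p.2.2.1 (hne p)))
  have hq : Continuous q := by
    refine (continuous_pi fun i => continuous_pi fun j => ?_).subtype_mk _
    refine (continuous_offDiagMap hπ).comp (f := fun p : S =>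
      (⟨(p.1.1.1 i j, p.1.2.1 i j), congrFun (congrFun (congrArg Subtype.val p.2.2.1) i) j,
        fun hij => hne p (π.nerve_eq_of_arrow_eq p.2.2.1 i j hij)⟩ : π.OffDiag)) ?_
    exact (((Nerve.continuous_arrow i j).comp (continuous_fst.comp continuous_subtype_val)).prodMk
      ((Nerve.continuous_arrow i j).comp (continuous_snd.comp continuous_subtype_val))).subtype_mk _
  refine ⟨range q, isCompact_range hq, fun c d hcd hf => ?_⟩
  have hcd' : π.nerveMap (π.nerveIncl c) = π.nerveMap (π.nerveIncl d) := by
    rw [nerveMap_nerveIncl, hcd, nerveMap_nerveIncl]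
  -- Of two different values one is nonzero. Its point lies in the support, and the saturated set
  -- `M` then contains both points.
  have hmem : π.nerveIncl c ∈ M ∧ π.nerveIncl d ∈ M := by
    by_cases h0 : f (π.nerveIncl c) = 0
    · have h1 : π.nerveIncl d ∈ tsupport f := subset_tsupport _ fun h => hf (h0.trans h.symm)
      exact ⟨⟨_, h1, hcd'.symm⟩, ⟨_, h1, rfl⟩⟩
    · have h1 : π.nerveIncl c ∈ tsupport f := subset_tsupport _ h0
      exact ⟨⟨_, h1, rfl⟩, ⟨_, h1, hcd'⟩⟩
  exact ⟨⟨(π.nerveIncl c, π.nerveIncl d), hmem, hcd', hf⟩, rfl⟩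

end Metric

end FactorMap


/-! ### The reduction isomorphism -/

/-- A relation between abelian groups that is additive, total and onto, and respects the kernels
of two quotient maps induces an isomorphism of the quotients. -/
theorem exists_addEquiv_of_relation {M N Q Q' : Type*} [AddCommGroup M] [AddCommGroup N]
    [AddCommGroup Q] [AddCommGroup Q'] (R : AddSubgroup (M × N)) (α : M →+ Q) (β : N →+ Q')
    (hα : Function.Surjective α) (hβ : Function.Surjective β) (hR : ∀ m, ∃ n, (m, n) ∈ R)
    (hR' : ∀ n, ∃ m, (m, n) ∈ R) (hk : ∀ m n, (m, n) ∈ R → (α m = 0 ↔ β n = 0)) :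
    ∃ e : Q ≃+ Q', ∀ m n, (m, n) ∈ R → e (α m) = β n := by
  let a : R →+ Q := α.comp ((AddMonoidHom.fst M N).comp R.subtype)
  let b : R →+ Q' := β.comp ((AddMonoidHom.snd M N).comp R.subtype)
  have ha : Function.Surjective a := fun q => by
    obtain ⟨m, rfl⟩ := hα q
    obtain ⟨n, hn⟩ := hR m
    exact ⟨⟨(m, n), hn⟩, rfl⟩
  have hb : Function.Surjective b := fun q => by
    obtain ⟨n, rfl⟩ := hβ q
    obtain ⟨m, hm⟩ := hR' n
    exact ⟨⟨(m, n), hm⟩, rfl⟩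
  -- Both `Q` and `Q'` are quotients of `R`, and the hypothesis `hk` says that they are quotients by
  -- the same subgroup.
  have hab : a.ker = b.ker := by
    ext ⟨⟨m, n⟩, h⟩
    exact hk m n h
  let ea := QuotientAddGroup.quotientKerEquivOfSurjective a ha
  let eb := QuotientAddGroup.quotientKerEquivOfSurjective b hb
  refine ⟨(ea.symm.trans (QuotientAddGroup.quotientAddEquivOfEq hab)).trans eb, fun m n h => ?_⟩
  have h1 : ea.symm (α m) = QuotientAddGroup.mk (⟨(m, n), h⟩ : R) := by
    rw [AddEquiv.symm_apply_eq]
    rfl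
  change eb (QuotientAddGroup.quotientAddEquivOfEq hab (ea.symm (α m))) = β n
  rw [h1]
  rfl

theorem fibreSum_sub {X Y A : Type*} [AddCommGroup A] (p : X → Y) (f g : X → A) (y : Y)
    (hf : {x | p x = y ∧ f x ≠ 0}.Finite) (hg : {x | p x = y ∧ g x ≠ 0}.Finite) :
    fibreSum p (fun x => f x - g x) y = fibreSum p f y - fibreSum p g y := by
  have key (f : X → A) (hf : {x | p x = y ∧ f x ≠ 0}.Finite) :
      (Function.support fun x : p ⁻¹' {y} => f x).Finite :=
    Set.Finite.of_finite_image (hf.subset (by rintro _ ⟨x, hx, rfl⟩; exact ⟨x.2, hx⟩))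
      Subtype.val_injective.injOn
  exact finsum_sub_distrib (key f hf) (key g hg)

/-- Homology in degree `0` is the cokernel of the differential, and cokernels preserve epimorphisms.
This ends the long exact sequences. -/
theorem ChainComplex.epi_homologyMap_zero {C : Type*} [Category* C] [Abelian C]
    {K L : ChainComplex C ℕ} (φ : K ⟶ L) [Epi φ] : Epi (HomologicalComplex.homologyMap φ 0) := by
  have h : HomologicalComplex.homologyMap φ 0 = K.isoHomologyι₀.hom ≫
      HomologicalComplex.opcyclesMap φ 0 ≫ L.isoHomologyι₀.inv := by
    rw [← Iso.inv_comp_eq]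
    exact ChainComplex.isoHomologyι₀_inv_naturality φ
  rw [h]
  infer_instance

namespace FactorMap

variable {G G' : Type u} [GroupoidStr G] [GroupoidStr G']

/-! ### Long exact sequences, classes and boundaries -/

section Exact

variable [TopologicalSpace G] [TopologicalSpace G'] [IsEtale G] [IsEtale G'] (π : FactorMap G G')
  (A : Type v) [AddCommGroup A] [TopologicalSpace A] [DiscreteTopology A]

theorem mono_chainMap : Mono (π.chainMap A) := by
  have (n : ℕ) : Mono ((π.chainMap A).f n) := by
    rw [AddCommGrpCat.mono_iff_injective]
    intro f g hfg
    refine DFunLike.ext (F := C_c(Nerve G' (Fin (n + 1)), A)) f g fun c => ?_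
    obtain ⟨c, rfl⟩ := π.nerveMap_surjective c
    exact DFunLike.congr_fun (F := C_c(Nerve G (Fin (n + 1)), A)) hfg c
  exact HomologicalComplex.mono_of_mono_f _ this

theorem shortExact_chainSequence : (π.chainSequence A).ShortExact where
  exact := ShortComplex.exact_cokernel _
  mono_f := π.mono_chainMap A
  epi_g := by
    have : Epi (Limits.cokernel.π (π.chainMap A)) := inferInstance
    exact this

theorem longExact (h : (π.chainSequence A).ShortExact) :
    (∀ n, Function.Exact (π.homologyPullback A n) (π.homologyQuotient A n)) ∧
    (∀ n, Function.Exact (π.homologyQuotient A (n + 1)) (π.connecting A h n)) ∧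
    (∀ n, Function.Exact (π.connecting A h n) (π.homologyPullback A n)) ∧
    Function.Surjective (π.homologyQuotient A 0) := by
  refine ⟨fun n => ?_, fun n => ?_, fun n => ?_, ?_⟩
  · exact (ShortComplex.ab_exact_iff_function_exact _).1 (h.homology_exact₂ n)
  · exact (ShortComplex.ab_exact_iff_function_exact _).1 (h.homology_exact₃ (n + 1) n rfl)
  · exact (ShortComplex.ab_exact_iff_function_exact _).1 (h.homology_exact₁ (n + 1) n rfl)
  · rw [← AddCommGrpCat.epi_iff_surjective]
    exact ChainComplex.epi_homologyMap_zero (Limits.cokernel.π (π.chainMap A))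

/-- The class map as a homomorphism. -/
noncomputable def relClassHom (n : ℕ) : C_c(Nerve G (Fin (n + 1)), A) →+ (π.relChains A).X n :=
  ((Limits.cokernel.π (π.chainMap A)).f n).hom

theorem relClassHom_surjective (n : ℕ) : Function.Surjective (π.relClassHom A n) :=
  (AddCommGrpCat.epi_iff_surjective ((Limits.cokernel.π (π.chainMap A)).f n)).1 inferInstance

/-- Exactness in each degree identifies the kernel with the pulled-back functions, and along a
proper surjection these are the functions constant on fibres. -/
theorem relClassHom_eq_zero_iff (n : ℕ) (f : C_c(Nerve G (Fin (n + 1)), A)) :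
    π.relClassHom A n f = 0 ↔ Function.FactorsThrough f π.nerveMap := by
  have h := (ShortComplex.ab_exact_iff_function_exact _).1
    ((HomologicalComplex.shortExact_iff_degreewise_shortExact _).1
      (π.shortExact_chainSequence A) n).exact
  exact (h f).trans (exists_pullback_eq_iff (π.isProperMap_nerveMap _) π.nerveMap_surjective f)

/-- The differential of `C(G, A)`. -/
noncomputable def boundary (G : Type u) [TopologicalSpace G] [GroupoidStr G] [IsEtale G] (n : ℕ) :
    C_c(Nerve G (Fin (n + 2)), A) →+ C_c(Nerve G (Fin (n + 1)), A) :=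
  ((chains G A).d (n + 1) n).hom

theorem d_relClassHom (n : ℕ) (f : C_c(Nerve G (Fin (n + 2)), A)) :
    ((π.relChains A).d (n + 1) n).hom (π.relClassHom A (n + 1) f) =
      π.relClassHom A n (boundary A G n f) :=
  ConcreteCategory.congr_hom ((Limits.cokernel.π (π.chainMap A)).comm (n + 1) n) f

theorem boundary_apply (n : ℕ) (f : C_c(Nerve G (Fin (n + 2)), A)) :
    boundary A G n f = ∑ i : Fin (n + 2), (-1 : ℤ) ^ (i : ℕ) •
      pushforward A (Nerve.map (SimplexCategory.δ i).toOrderHom)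
        (IsEtale.isLocalHomeomorph_map _) f := by
  have h : (chains G A).d (n + 1) n =
      ∑ i : Fin (n + 2), (-1 : ℤ) ^ (i : ℕ) • (nerveFunctions G A).δ i :=
    AlgebraicTopology.alternatingFaceMapComplex_obj_d _ _
  have hs := map_sum (AddCommGrpCat.homAddEquiv (M := (chains G A).X (n + 1)) (N := (chains G A).X n))
    (fun i : Fin (n + 2) => (-1 : ℤ) ^ (i : ℕ) • (nerveFunctions G A).δ i) Finset.univ
  unfold boundary
  rw [h]
  exact (DFunLike.congr_fun hs f).trans (AddMonoidHom.finsetSum_apply _ _ _)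

end Exact

/-! ### The reduction relation and the induced isomorphism -/

section Reduction

variable [MetricSpace G] [TopologicalSpace G'] [IsEtale G'] (π : FactorMap G G')
  (A : Type v) [AddCommGroup A] [TopologicalSpace A] [DiscreteTopology A] {ι κ : Type}

/-- The pairs of functions whose difference on `G_π⁽ⁿ⁾` is constant on the fibres over
`G'_π⁽ⁿ⁾`. -/
def reductionRel (ι : Type) : AddSubgroup (C_c(Nerve G ι, A) × C_c(Nerve π.Total ι, A)) where
  carrier := {p | Function.FactorsThrough (fun c => p.1 (π.nerveIncl c) - p.2 c)
    π.reduced.nerveMap}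
  zero_mem' := fun _ _ _ => rfl
  add_mem' {p q} hp hq := fun c d h => by
    have h1 := hp h
    have h2 := hq h
    dsimp only at h1 h2
    change p.1 _ + q.1 _ - (p.2 _ + q.2 _) = p.1 _ + q.1 _ - (p.2 _ + q.2 _)
    rw [add_sub_add_comm, h1, h2, add_sub_add_comm]
  neg_mem' {p} hp := fun c d h => by
    have h1 := hp h
    dsimp only at h1
    change -p.1 _ - -p.2 _ = -p.1 _ - -p.2 _
    rw [← neg_sub', h1, neg_sub']

variable {A}

/-- Distinct points of one fibre lie in the nerve of `G_π`, so constancy of `f` can be tested there,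
where `f` and `g` differ by a function constant on fibres. -/
theorem factorsThrough_iff_of_mem_reductionRel [Nonempty ι] {f : C_c(Nerve G ι, A)}
    {g : C_c(Nerve π.Total ι, A)} (h : (f, g) ∈ π.reductionRel A ι) :
    Function.FactorsThrough f π.nerveMap ↔ Function.FactorsThrough g π.reduced.nerveMap := by
  replace h : Function.FactorsThrough (fun c => f (π.nerveIncl c) - g c) π.reduced.nerveMap := h
  constructor
  · intro hf c d hcd
    have h1 := h hcd
    have h2 : f (π.nerveIncl c) = f (π.nerveIncl d) := hf (by
      rw [nerveMap_nerveIncl, hcd, nerveMap_nerveIncl])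
    dsimp only at h1
    rw [h2] at h1
    exact sub_right_injective h1
  · intro hg c d hcd
    by_contra hf
    have hne : c ≠ d := fun h => hf (by rw [h])
    have hcd' : π.reduced.nerveMap (π.toNerveTotal c (π.nontrivial_of_ne hcd hne)) =
        π.reduced.nerveMap (π.toNerveTotal d (π.nontrivial_of_ne hcd.symm hne.symm)) :=
      π.nerveInclBase_injective hcd
    have h1 := h hcd'
    have h2 := hg hcd'
    dsimp only at h1
    rw [h2] at h1
    exact hf (sub_left_injective h1)

variable [IsEtale G] [IsEtale π.Total]

/-- Unique lifting turns fibre sums in the nerves of `G` and of `G'_π` into fibre sums in the nerve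
of `G_π`. The difference of the pushforwards is then pulled back from a fibre sum over `G'_π`. -/
theorem pushforward_mem_reductionRel [Finite ι] [Finite κ] [Nonempty κ] (θ : κ → ι)
    {f : C_c(Nerve G ι, A)} {g : C_c(Nerve π.Total ι, A)} (h : (f, g) ∈ π.reductionRel A ι) :
    (pushforward A (Nerve.map θ) (IsEtale.isLocalHomeomorph_map θ) f,
      pushforward A (Nerve.map θ) (IsEtale.isLocalHomeomorph_map θ) g) ∈ π.reductionRel A κ := by
  replace h : Function.FactorsThrough (fun c => f (π.nerveIncl c) - g c) π.reduced.nerveMap := h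
  have : Nonempty ι := ‹Nonempty κ›.map θ
  let k : Nerve π.Total ι → A := fun c => f (π.nerveIncl c) - g c
  -- A bare function suffices here: the finiteness of the sums comes from `f` and `g`, so `k'` needs
  -- neither continuity nor compact support.
  let k' : Nerve π.Base ι → A := fun b => k (Function.surjInv π.reduced.nerveMap_surjective b)
  have hk (c) : k' (π.reduced.nerveMap c) = k c := h (Function.surjInv_eq _ _)
  have key (z : Nerve π.Total κ) : pushforward A (Nerve.map θ) (IsEtale.isLocalHomeomorph_map θ) f
      (π.nerveIncl z) - pushforward A (Nerve.map θ) (IsEtale.isLocalHomeomorph_map θ) g z =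
        fibreSum (Nerve.map θ) k' (π.reduced.nerveMap z) := by
    have h1 : fibreSum (Nerve.map θ) f (π.nerveIncl z) =
        fibreSum (Nerve.map θ) (fun c => f (π.nerveIncl c)) z :=
      fibreSum_eq_of_existsUnique (q := π.nerveIncl)
        (fun x hx => by rw [← hx]; rfl) (π.existsUnique_nerveIncl θ z) f
    have h2 : fibreSum (Nerve.map θ) k' (π.reduced.nerveMap z) =
        fibreSum (Nerve.map θ) (fun c => k' (π.reduced.nerveMap c)) z :=
      fibreSum_eq_of_existsUnique (fun x hx => by rw [← hx]; rfl) (π.reduced.nerve_lift θ z) k'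
    rw [h2, funext hk]
    change fibreSum (Nerve.map θ) f (π.nerveIncl z) - fibreSum (Nerve.map θ) g z = _
    rw [h1, ← fibreSum_sub]
    · refine Set.Finite.of_finite_image ((finite_fibre (IsEtale.isLocalHomeomorph_map θ) f
        (π.nerveIncl z)).subset ?_) π.nerveIncl_injective.injOn
      rintro _ ⟨x, ⟨hx, h0⟩, rfl⟩
      exact ⟨by rw [← hx]; rfl, h0⟩
    · exact finite_fibre (IsEtale.isLocalHomeomorph_map θ) g z
  intro c d hcd
  dsimp only
  rw [key, key, hcd]

theorem boundary_mem_reductionRel (n : ℕ) {f : C_c(Nerve G (Fin (n + 2)), A)}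
    {g : C_c(Nerve π.Total (Fin (n + 2)), A)} (h : (f, g) ∈ π.reductionRel A (Fin (n + 2))) :
    (boundary A G n f, boundary A π.Total n g) ∈ π.reductionRel A (Fin (n + 1)) := by
  rw [boundary_apply, boundary_apply]
  have : (∑ i : Fin (n + 2), (-1 : ℤ) ^ (i : ℕ) •
      (pushforward A (Nerve.map (SimplexCategory.δ i).toOrderHom)
        (IsEtale.isLocalHomeomorph_map _) f,
      pushforward A (Nerve.map (SimplexCategory.δ i).toOrderHom)
        (IsEtale.isLocalHomeomorph_map _) g)) ∈ π.reductionRel A (Fin (n + 1)) :=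
    sum_mem fun i _ => zsmul_mem (π.pushforward_mem_reductionRel _ h) _
  convert this
  · simp [Prod.fst_sum]
  · simp [Prod.snd_sum]

variable {π} [IsEtale π.Base] [TotallyDisconnectedSpace G']

/-- Every function in `C_c(G⁽ⁿ⁾, A)` is related to its restrictions to large compact open sets. -/
theorem exists_cutoff_mem_reductionRel [Finite ι] (hπ : IsRegularMap π) (f : C_c(Nerve G ι, A)) :
    ∃ L : Set (Nerve π.Base ι), IsCompact L ∧ IsOpen L ∧
      ∀ K : Set (Nerve π.Base ι), IsCompact K → IsOpen K → L ⊆ K →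
        ∃ fK : C_c(Nerve π.Total ι, A),
          (∀ c, π.reduced.nerveMap c ∈ K → fK c = f (π.nerveIncl c)) ∧
          (∀ c, π.reduced.nerveMap c ∉ K → fK c = 0) ∧ (f, fK) ∈ π.reductionRel A ι := by
  have := π.totallyDisconnectedSpace_base
  obtain ⟨D, hD, hfD⟩ := exists_isCompact_nonconstant hπ f
  obtain ⟨L, hL, hLo, hDL, -⟩ := hD.exists_isCompact_isOpen_between isOpen_univ (subset_univ _)
  refine ⟨L, hL, hLo, fun K hK hKo hLK => ?_⟩
  have hp := π.reduced.isProperMap_nerveMap ι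
  let fK : C_c(Nerve π.Total ι, A) := cutoff (fun c => f (π.nerveIncl c))
    (f.continuous.comp π.continuous_nerveIncl) (π.reduced.nerveMap ⁻¹' K)
    (hp.isCompact_preimage hK) (hKo.preimage hp.continuous)
  have h1 (c) (hc : π.reduced.nerveMap c ∈ K) : fK c = f (π.nerveIncl c) := cutoff_of_mem hc
  have h2 (c) (hc : π.reduced.nerveMap c ∉ K) : fK c = 0 := cutoff_of_notMem hc
  refine ⟨fK, h1, h2, fun c d hcd => ?_⟩
  dsimp only
  -- Over `K` the difference vanishes. Off `K` it is `f`, which is constant on fibres there because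
  -- `K` contains `D`.
  by_cases hc : π.reduced.nerveMap c ∈ K
  · rw [h1 c hc, h1 d (hcd ▸ hc), sub_self, sub_self]
  · rw [h2 c hc, h2 d (hcd ▸ hc)]
    by_contra hne
    exact hc (hLK (hDL (hfD c d hcd fun h => hne (by rw [h]))))

variable [TotallyDisconnectedSpace G]

/-- Every function in `C_c(G_π⁽ⁿ⁾, A)` is related to a function in `C_c(G⁽ⁿ⁾, A)`. -/
theorem exists_mem_reductionRel [Finite ι] (hπ : IsRegularMap π) (g : C_c(Nerve π.Total ι, A)) :
    ∃ f : C_c(Nerve G ι, A), (f, g) ∈ π.reductionRel A ι := by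
  have := π.totallyDisconnectedSpace_base
  have hp := π.reduced.isProperMap_nerveMap ι
  have hp' := π.isProperMap_nerveMap ι
  obtain ⟨K, hK, hKo, hgK, -⟩ := (g.hasCompactSupport.isCompact.image
    hp.continuous).exists_isCompact_isOpen_between isOpen_univ (subset_univ _)
  obtain ⟨F, hF⟩ := exists_extension (g := g) π.continuous_nerveIncl
    π.nerveIncl_injective g.continuous
    (hp.isCompact_preimage hK)
  obtain ⟨D, hD, hFD⟩ := exists_isCompact_nonconstant hπ F
  -- The extension `F` may vary on fibres outside `K`, but only over the compact set `D \ K`. Its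
  -- image in the nerve of `G'` is separated from that of `K` by the compact open set `V`, and
  -- cutting `F` off by `V` removes these fibres while keeping the values over `K`.
  obtain ⟨V, hV, hVo, hKV, hVD⟩ := (hK.image
    π.continuous_nerveInclBase).exists_isCompact_isOpen_between
      (U := (π.nerveInclBase '' (D \ K))ᶜ)
      ((hD.diff hKo).image π.continuous_nerveInclBase).isClosed.isOpen_compl <| by
        rintro _ ⟨b, hb, rfl⟩ ⟨b', hb', hbb⟩
        exact hb'.2 (π.nerveInclBase_injective hbb ▸ hb)
  let f : C_c(Nerve G ι, A) := cutoff F F.continuous (π.nerveMap ⁻¹' V)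
    (hp'.isCompact_preimage hV) (hVo.preimage hp'.continuous)
  have h1 (c : Nerve π.Total ι) (hc : π.nerveInclBase (π.reduced.nerveMap c) ∈ V) :
      f (π.nerveIncl c) = F (π.nerveIncl c) := cutoff_of_mem hc
  have h2 (c : Nerve π.Total ι) (hc : π.nerveInclBase (π.reduced.nerveMap c) ∉ V) :
      f (π.nerveIncl c) = 0 := cutoff_of_notMem hc
  have hg (c : Nerve π.Total ι) (hc : π.reduced.nerveMap c ∉ K) : g c = 0 :=
    image_eq_zero_of_notMem_tsupport fun h => hc (hgK ⟨c, h, rfl⟩)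
  refine ⟨f, fun c d hcd => ?_⟩
  dsimp only
  by_cases hc : π.reduced.nerveMap c ∈ K
  · have hd : π.reduced.nerveMap d ∈ K := hcd ▸ hc
    rw [h1 c (hKV ⟨_, hc, rfl⟩), h1 d (hKV ⟨_, hd, rfl⟩), hF c hc, hF d hd, sub_self, sub_self]
  · rw [hg c hc, hg d (hcd ▸ hc)]
    by_cases hcV : π.nerveInclBase (π.reduced.nerveMap c) ∈ V
    · rw [h1 c hcV, h1 d (hcd ▸ hcV)]
      by_contra hne
      exact hVD hcV ⟨_, ⟨hFD c d hcd fun h => hne (by rw [h]), hc⟩, rfl⟩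
    · rw [h2 c hcV, h2 d (hcd ▸ hcV)]

variable (A) in
theorem exists_reductionIso (hπ : IsRegularMap π) :
    ∃ Φ : π.relChains A ≅ π.reduced.relChains A, π.IsReduction π.reduced Φ.hom := by
  have h1 (n : ℕ) (f : C_c(Nerve G (Fin (n + 1)), A)) :
      ∃ g, (f, g) ∈ π.reductionRel A (Fin (n + 1)) := by
    obtain ⟨L, hL, hLo, h⟩ := exists_cutoff_mem_reductionRel hπ f
    obtain ⟨g, -, -, hg⟩ := h L hL hLo subset_rfl
    exact ⟨g, hg⟩
  choose e he using fun n : ℕ => exists_addEquiv_of_relation (π.reductionRel A (Fin (n + 1)))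
    (π.relClassHom A n) (π.reduced.relClassHom A n) (π.relClassHom_surjective A n)
    (π.reduced.relClassHom_surjective A n) (h1 n) (exists_mem_reductionRel hπ) fun f g h => by
      rw [relClassHom_eq_zero_iff, relClassHom_eq_zero_iff]
      exact π.factorsThrough_iff_of_mem_reductionRel h
  refine ⟨HomologicalComplex.Hom.isoOfComponents (fun n => (e n).toAddCommGrpIso) ?_, ?_⟩
  -- Compatibility with the differentials is checked on a related pair, whose boundaries are again
  -- related.
  · rintro _ n rfl
    ext q
    obtain ⟨f, rfl⟩ := π.relClassHom_surjective A (n + 1) q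
    obtain ⟨g, hg⟩ := h1 (n + 1) f
    change ((π.reduced.relChains A).d (n + 1) n).hom (e (n + 1) (π.relClassHom A (n + 1) f)) =
      e n (((π.relChains A).d (n + 1) n).hom (π.relClassHom A (n + 1) f))
    rw [he _ f g hg, d_relClassHom, d_relClassHom,
      he n _ _ (π.boundary_mem_reductionRel n hg)]
  · intro n f
    obtain ⟨L, hL, hLo, h⟩ := exists_cutoff_mem_reductionRel hπ f
    refine ⟨L, hL, hLo, fun K hK hKo hLK => ?_⟩
    obtain ⟨fK, hfK1, hfK2, hR⟩ := h K hK hKo hLK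
    exact ⟨fK, hfK1, hfK2, he n f fK hR⟩

end Reduction

end FactorMap

theorem theorem4p17 {G G' : Type u} [MetricSpace G] [TopologicalSpace G']
    [GroupoidStr G] [GroupoidStr G'] [IsEtale G] [IsEtale G']
    [TotallyDisconnectedSpace G] [TotallyDisconnectedSpace G']
    (π : FactorMap G G') (hπ : IsRegularMap π)
    (A : Type v) [AddCommGroup A] [TopologicalSpace A] [DiscreteTopology A] :
    ∃ (_ : IsEtale π.Total) (_ : IsEtale π.Base) (ρ : FactorMap π.Total π.Base),
      (∀ g, ρ g = π.proj g) ∧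
      ∃ (h : (π.chainSequence A).ShortExact) (h' : (ρ.chainSequence A).ShortExact),
        -- the sequence for `G → G'` is exact
        (∀ n, Function.Exact (π.homologyPullback A n) (π.homologyQuotient A n)) ∧
        (∀ n, Function.Exact (π.homologyQuotient A (n + 1)) (π.connecting A h n)) ∧
        (∀ n, Function.Exact (π.connecting A h n) (π.homologyPullback A n)) ∧
        Function.Surjective (π.homologyQuotient A 0) ∧
        -- the sequence for `G_π → G'_π` is exact
        (∀ n, Function.Exact (ρ.homologyPullback A n) (ρ.homologyQuotient A n)) ∧
        (∀ n, Function.Exact (ρ.homologyQuotient A (n + 1)) (ρ.connecting A h' n)) ∧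
        (∀ n, Function.Exact (ρ.connecting A h' n) (ρ.homologyPullback A n)) ∧
        Function.Surjective (ρ.homologyQuotient A 0) ∧
        -- the relative groups are identified through the reduction
        ∃ Φ : π.relChains A ≅ ρ.relChains A, π.IsReduction ρ Φ.hom ∧
          ∃ e : ∀ n, π.relHomology A n ≅ ρ.relHomology A n,
            ∀ n, (e n).hom = HomologicalComplex.homologyMap Φ.hom n := by
  have hB : IsEtale π.Base := FactorMap.isEtale_base hπ
  have hT : IsEtale π.Total := π.isEtale_total
  have h := π.shortExact_chainSequence A
  have h' := π.reduced.shortExact_chainSequence A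
  obtain ⟨h1, h2, h3, h4⟩ := π.longExact A h
  obtain ⟨k1, k2, k3, k4⟩ := π.reduced.longExact A h'
  obtain ⟨Φ, hΦ⟩ := FactorMap.exists_reductionIso A hπ
  exact ⟨hT, hB, π.reduced, fun _ => rfl, h, h', h1, h2, h3, h4, k1, k2, k3, k4, Φ, hΦ,
    fun n => HomologicalComplex.homologyMapIso Φ n, fun _ => rfl⟩
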